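/- Let $\lambda>0$, and let $\eta$ be Gaussian white noise on $\mathbb{R}$ (the centred Gaussian process $f\mapsto\int f\eta$ indexed by $f\in L^2(\mathbb{R})$ with $\langle\int f\eta\cdot\int g\eta\rangle=\int fg$), with Fourier transform $\widetilde\eta(k)=\frac{1}{\sqrt{2\pi}}\int e^{-ikx}\eta(x)\,dx$. For $a>1/2$ and $s\in\mathbb{R}$ put $$Y_{a,\lambda}(s)=\frac{1}{\sqrt{2\pi}}\int_{-\infty}^{\infty}\frac{e^{iks}\,\widetilde\eta(k)\,dk}{(k^2+\lambda^2)^{a/2}} .$$ Let $\alpha:\mathbb{R}\to\mathbb{R}$ be H\"older continuous, $|\alpha(t)-\alpha(s)|\le K|t-s|^{\kappa}$ for all $s,t\in\mathbb R$, with an exponent $0<\kappa\le 1$ and a constant $K\ge 0$, and suppose that $1/2<\alpha(t)<\kappa+1/2$ for all $t$. Let $B_{\alpha(t),\lambda}(t)=Y_{\alpha(t),\lambda}(t)-Y_{\alpha(t),\lambda}(0)$ be the tempered multifractional Brownian motion (both terms carry the index $\alpha(t)$). Fix $t\in\mathbb{R}$ and put $H=\alpha(t)-\frac12$ and $$c=-\frac{\Gamma\bigl(\frac12-\alpha(t)\bigr)}{2^{2\alpha(t)-1}\sqrt{\pi}\,\Gamma(\alpha(t))}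 .$$ Then $c>0$, and the following holds both for $Z(s)=Y_{\alpha(s),\lambda}(s)$ and for $Z(s)=B_{\alpha(s),\lambda}(s)$. (1) For all $u,v\in\mathbb{R}$, $$\lim_{\epsilon\to0^+}\left\langle\frac{Z(t+\epsilon u)-Z(t)}{\epsilon^{H}}\cdot\frac{Z(t+\epsilon v)-Z(t)}{\epsilon^{H}}\right\rangle=\frac{c}{2}\Bigl(|u|^{2\alpha(t)-1}+|v|^{2\alpha(t)-1}-|u-v|^{2\alpha(t)-1}\Bigr).$$ (2) $Z$ is locally asymptotically self-similar of order $H$ at $t$, and its tangent process at $t$ is, up to a multiplicative constant, fractional Brownian motion with Hurst index $H=\alpha(t)-\frac12\in(0,1)$: as $\epsilon\to0^+$ the finite dimensional distributions of $u\mapsto\epsilon^{-H}\bigl(Z(t+\epsilon u)-Z(t)\bigr)$, $u\in\mathbb{R}$, converge weakly to those of the non-degenerate process $\sqrt{c}\,W_H(u)$, where $W_H$ is the centred Gaussian process with covariance $\frac12\bigl(|u|^{2H}+|v|^{2H}-|u-v|^{2H}\bigr)$. -/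

import Mathlib

open MeasureTheory ProbabilityTheory Filter Topology FourierTransform
open scoped NNReal ENNReal

noncomputable section

namespace TMBM

/-- Gaussian white noise on the real line, as the centred Gaussian process `f ↦ ∫ f(x) η(x) dx`
indexed by `f ∈ L²(ℝ)`, with delta-correlated covariance
`⟨∫ f η · ∫ g η⟩ = ∫ f(x) g(x) dx`. -/
structure IsWhiteNoise {Ω : Type*} [MeasurableSpace Ω]
    (η : Lp ℝ 2 (volume : Measure ℝ) → Ω → ℝ) (P : Measure Ω) : Prop where
  gaussian : IsGaussianProcess η P
  centred : ∀ f, ∫ ω, η f ω ∂P = 0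
  covariance : ∀ f g, ∫ ω, η f ω * η g ω ∂P = inner ℝ f g

/-- The unitary Fourier transform in angular frequency,
`f ↦ (x ↦ (2π)^(-1/2) ∫ e^{-ikx} f(k) dk)`, on square integrable `f` (and `0` otherwise).
It is Mathlib's `L²` Fourier transform, whose kernel is `e^{-2πimx}`, applied after the
substitution `k = 2πm` to `m ↦ (2π)^(1/2) f(2πm)`. -/
def angularFourier (f : ℝ → ℂ) : Lp ℂ 2 (volume : Measure ℝ) :=
  open Classical in
  if h : MemLp (fun m : ℝ => (Real.sqrt (2 * Real.pi) : ℂ) * f (2 * Real.pi * m)) 2 volume then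
    𝓕 (h.toLp)
  else 0

/-- The stochastic integral `∫ f(k) η̃(k) dk` against the Fourier transform
`η̃(k) = (2π)^(-1/2) ∫ e^{-ikx} η(x) dx` of the white noise `η`; it is the integral against `η`
of the (complex valued) Fourier transform of `f`. -/
def spectralIntegral {Ω : Type*} (η : Lp ℝ 2 (volume : Measure ℝ) → Ω → ℝ) (f : ℝ → ℂ)
    (ω : Ω) : ℂ :=
  ⟨η (Complex.reCLM.compLp (angularFourier f)) ω, η (Complex.imCLM.compLp (angularFourier f)) ω⟩

/-- The field `Y_{a,λ}(s) = (2π)^(-1/2) ∫ e^{iks} (k² + λ²)^(-a/2) η̃(k) dk` with index `a` at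
time `s`. The integrand `g` has the symmetry `g(-k) = conj (g(k))`, so its Fourier transform is
real and the integral is almost surely real; the real part makes it a real random variable. -/
def Y {Ω : Type*} (η : Lp ℝ 2 (volume : Measure ℝ) → Ω → ℝ) (lam a s : ℝ) (ω : Ω) : ℝ :=
  (spectralIntegral η (fun k : ℝ => ((Real.sqrt (2 * Real.pi))⁻¹ : ℂ) *
    (Complex.exp (Complex.I * k * s) * (((k ^ 2 + lam ^ 2) ^ (-a / 2) : ℝ) : ℂ))) ω).re

/-- The multifractional process `t ↦ Y_{α(t),λ}(t)`. -/
def multifractionalOU {Ω : Type*} (η : Lp ℝ 2 (volume : Measure ℝ) → Ω → ℝ) (α : ℝ → ℝ)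
    (lam t : ℝ) (ω : Ω) : ℝ :=
  Y η lam (α t) t ω

/-- Tempered multifractional Brownian motion `B_{α(t),λ}(t) = Y_{α(t),λ}(t) - Y_{α(t),λ}(0)`;
both terms carry the index `α(t)`. -/
def temperedMBM {Ω : Type*} (η : Lp ℝ 2 (volume : Measure ℝ) → Ω → ℝ) (α : ℝ → ℝ)
    (lam t : ℝ) (ω : Ω) : ℝ :=
  Y η lam (α t) t ω - Y η lam (α t) 0 ω

/-- Fractional Brownian motion on the real line with Hurst index `H` (in the sense of finite
dimensional distributions), normalised by `⟨W(1)²⟩ = 1`. -/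
structure IsFBM {Ω : Type*} [MeasurableSpace Ω] (H : ℝ) (W : ℝ → Ω → ℝ) (P : Measure Ω) :
    Prop where
  hurst : 0 < H ∧ H < 1
  gaussian : IsGaussianProcess W P
  centred : ∀ u, ∫ ω, W u ω ∂P = 0
  covariance : ∀ u v, ∫ ω, W u ω * W v ω ∂P =
    (|u| ^ (2 * H) + |v| ^ (2 * H) - |u - v| ^ (2 * H)) / 2

/-- `Z` is locally asymptotically self-similar of order `κ` at the point `t₀`, with tangent
process `T`: as `ε → 0+`, the processes `u ↦ (Z(t₀ + εu) - Z(t₀)) / ε^κ` converge to `T` in the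
sense of finite dimensional distributions, and `T` is non-degenerate (no `T(u)` with `u ≠ 0` is
almost surely constant). -/
structure IsLocallyAsymptoticallySelfSimilar {Ω Ω' : Type*} [MeasurableSpace Ω]
    [MeasurableSpace Ω'] (Z : ℝ → Ω → ℝ) (P : Measure Ω) [IsProbabilityMeasure P] (t₀ κ : ℝ)
    (T : ℝ → Ω' → ℝ) (P' : Measure Ω') [IsProbabilityMeasure P'] : Prop where
  tendsto : ∀ I : Finset ℝ,
    TendstoInDistribution
      (fun (ε : ℝ) (ω : Ω) (u : I) => (Z (t₀ + ε * (u : ℝ)) ω - Z t₀ ω) / ε ^ κ)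
      (𝓝[>] (0 : ℝ)) (fun (ω : Ω') (u : I) => T u ω) (fun _ => P) P'
  nondegenerate : ∀ u : ℝ, u ≠ 0 → ∀ c : ℝ, ¬ (T u =ᵐ[P'] fun _ => c)

/-- The covariance `⟨(Z(t+εu) - Z(t)) / ε^κ · (Z(t+εv) - Z(t)) / ε^κ⟩` of the rescaled increments
of `Z` at the point `t`. -/
def rescaledCov {Ω : Type*} [MeasurableSpace Ω] (Z : ℝ → Ω → ℝ) (P : Measure Ω)
    (t κ ε u v : ℝ) : ℝ :=
  ∫ ω, ((Z (t + ε * u) ω - Z t ω) / ε ^ κ) * ((Z (t + ε * v) ω - Z t ω) / ε ^ κ) ∂P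

/-- The constant `-Γ(1/2 - a) / (2^(2a-1) √π Γ(a))`, positive for `1/2 < a < 3/2`. -/
def tangentConst (a : ℝ) : ℝ :=
  -Real.Gamma (1 / 2 - a) / ((2 : ℝ) ^ (2 * a - 1) * Real.sqrt Real.pi * Real.Gamma a)

end TMBM

end

/-! Every value of the processes is, almost surely, the white noise `η` evaluated at some element of
real L², so covariances are inner products and the analysis takes place in that Hilbert space. By
Plancherel, inner products of kernel increments at a constant index a = α(t) reduce to the structure
function ∫ (1 - cos ku)(k² + λ²)^(-a) dk. Rescaling time by ε and substituting x = εk divides it by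
ε^(2a-1) and replaces λ by ελ. As ε → 0 the tempering disappears, and dominated convergence gives
the fractional Brownian value ∫ (1 - cos xu)|x|^(-2a) dx = πc|u|^(2a-1)
(`tendsto_rescaled_integral`, `integral_one_sub_cos_mul_mul_rpow`).

Variation of the index is negligible: the kernel is Lipschitz in the index, uniformly in time
(`exists_norm_spectralRe_kernel_sub_le`), so by Hölder continuity it contributes O(ε^κ), which is
o(ε^H) because H < κ. The subtracted term of tempered multifractional Brownian motion, taken at time
0, also changes only through its index and vanishes in the same way. Hence both processes have the
same limiting covariance (`tendsto_inner_add`).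

For centred Gaussian vectors, convergence of covariances gives convergence in law, through
characteristic functions. The limit is realised on the same noise by the kernel with λ = 0. -/

noncomputable section
namespace TMBM

/-! ### Centred Gaussian vectors and almost sure linearity of white noise. -/

section Gaussian

variable {Ω : Type*} [MeasurableSpace Ω] {P : Measure Ω}

lemma variance_sum_of_centred {ι : Type*} [Fintype ι] {X : ι → Ω → ℝ}
    (hX : ∀ i, MemLp (X i) 2 P) [IsProbabilityMeasure P] (h0 : ∀ i, ∫ ω, X i ω ∂P = 0) (x : ι → ℝ) :
    Var[fun ω => ∑ i, x i * X i ω; P] = ∑ i, ∑ j, x i * x j * ∫ ω, X i ω * X j ω ∂P := by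
  have hint : ∀ i j, Integrable (fun ω => X i ω * X j ω) P := fun i j =>
    (hX i).integrable_mul (hX j)
  have hm : ∫ ω, ∑ i, x i * X i ω ∂P = 0 := by
    rw [integral_finsetSum _ fun i _ => ((hX i).integrable (by norm_num)).const_mul _]
    simp [integral_const_mul, h0]
  rw [variance_of_integral_eq_zero _ hm]
  · have : ∀ ω, (∑ i, x i * X i ω) ^ 2 = ∑ i, ∑ j, x i * x j * (X i ω * X j ω) := fun ω => by
      rw [sq, Finset.sum_mul_sum]
      exact Finset.sum_congr rfl fun i _ => Finset.sum_congr rfl fun j _ => by ring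
    simp_rw [this]
    rw [integral_finsetSum _ fun i _ => integrable_finsetSum _ fun j _ => (hint i j).const_mul _]
    refine Finset.sum_congr rfl fun i _ => ?_
    rw [integral_finsetSum _ fun j _ => (hint i j).const_mul _]
    simp [integral_const_mul]
  · exact Finset.aemeasurable_fun_sum _ fun i _ => (hX i).aemeasurable.const_mul _

/-- The characteristic function of a centred Gaussian vector in terms of its covariance matrix. -/
lemma charFun_map_toLp_of_centred {ι : Type*} [Fintype ι] [IsProbabilityMeasure P]
    {X : ι → Ω → ℝ} (hX : HasGaussianLaw (fun ω i => X i ω) P) (h0 : ∀ i, ∫ ω, X i ω ∂P = 0)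
    (x : EuclideanSpace ℝ ι) :
    charFun (P.map fun ω => WithLp.toLp 2 fun i => X i ω) x =
      Complex.exp (-((∑ i, ∑ j, x i * x j * ∫ ω, X i ω * X j ω ∂P : ℝ) : ℂ) / 2) := by
  have hXi : ∀ i, MemLp (X i) 2 P := fun i => (hX.eval i).memLp_two
  rw [HasGaussianLaw.charFun_map_eq x (hX.toLp_pi 2)]
  have h1 : (fun ω => inner ℝ x (WithLp.toLp 2 fun i => X i ω)) =
      fun ω => ∑ i, x i * X i ω := by
    ext ω
    simp [PiLp.inner_apply, mul_comm]
  rw [h1, variance_sum_of_centred hXi h0]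
  have hm : ∫ ω, ∑ i, x i * X i ω ∂P = 0 := by
    rw [integral_finsetSum _ fun i _ => ((hXi i).integrable (by norm_num)).const_mul _]
    simp [integral_const_mul, h0]
  rw [hm]
  congr 1
  push_cast
  ring

/-- Centred Gaussian vectors whose covariance matrices converge, converge in distribution. -/
lemma tendstoInDistribution_of_tendsto_covariance {Ω' κ ι : Type*} [Fintype ι]
    [MeasurableSpace Ω'] {P' : Measure Ω'} [IsProbabilityMeasure P] [IsProbabilityMeasure P']
    {l : Filter κ} [l.IsCountablyGenerated]
    {X : κ → ι → Ω → ℝ} {T : ι → Ω' → ℝ}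
    (hX : ∀ n, HasGaussianLaw (fun ω i => X n i ω) P) (hX0 : ∀ n i, ∫ ω, X n i ω ∂P = 0)
    (hT : HasGaussianLaw (fun ω i => T i ω) P') (hT0 : ∀ i, ∫ ω, T i ω ∂P' = 0)
    (h : ∀ i j, Tendsto (fun n => ∫ ω, X n i ω * X n j ω ∂P) l
      (𝓝 (∫ ω, T i ω * T j ω ∂P'))) :
    TendstoInDistribution (fun n ω i => X n i ω) l (fun ω i => T i ω) (fun _ => P) P' := by
  have key : TendstoInDistribution (fun n ω => WithLp.toLp 2 fun i => X n i ω) l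
      (fun ω => WithLp.toLp 2 fun i => T i ω) (fun _ => P) P' := by
    refine ⟨fun n => (HasGaussianLaw.toLp_pi 2 (hX n)).aemeasurable,
      (HasGaussianLaw.toLp_pi 2 hT).aemeasurable, ?_⟩
    -- Lévy's continuity theorem is applied along sequences, which suffices for a countably
    -- generated filter.
    refine tendsto_of_seq_tendsto fun u hu => ?_
    refine ProbabilityMeasure.tendsto_of_tendsto_charFun fun x => ?_
    change Tendsto (fun n => charFun (P.map fun ω => WithLp.toLp 2 fun i => X (u n) i ω) x) atTop
      (𝓝 (charFun (P'.map fun ω => WithLp.toLp 2 fun i => T i ω) x))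
    simp_rw [fun n => charFun_map_toLp_of_centred (hX n) (hX0 n) x,
      charFun_map_toLp_of_centred hT hT0 x]
    refine (Complex.continuous_exp.tendsto _).comp ?_
    refine Tendsto.div_const (Tendsto.neg ?_) _
    refine (Complex.continuous_ofReal.tendsto _).comp ?_
    exact tendsto_finsetSum _ fun i _ => tendsto_finsetSum _ fun j _ =>
      ((h i j).comp hu).const_mul _
  -- The Euclidean structure served only to define characteristic functions; forgetting it is
  -- continuous.
  exact key.continuous_comp (g := WithLp.ofLp) (by fun_prop)

namespace IsWhiteNoise

variable {η : Lp ℝ 2 (volume : Measure ℝ) → Ω → ℝ}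

lemma memLp (hη : IsWhiteNoise η P) (f : Lp ℝ 2 (volume : Measure ℝ)) : MemLp (η f) 2 P :=
  (hη.gaussian.hasGaussianLaw_eval f).memLp_two

/-- White noise is almost surely linear. -/
lemma sum_ae_eq_zero [IsProbabilityMeasure P] (hη : IsWhiteNoise η P) {ι : Type*} [Fintype ι]
    (x : ι → ℝ) (f : ι → Lp ℝ 2 (volume : Measure ℝ)) (h : ∑ i, x i • f i = 0) :
    (fun ω => ∑ i, x i * η (f i) ω) =ᵐ[P] 0 := by
  have hv := variance_sum_of_centred (fun i => hη.memLp (f i)) (fun i => hη.centred (f i)) x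
  have hm : MemLp (fun ω => ∑ i, x i * η (f i) ω) 2 P :=
    memLp_finsetSum _ fun i _ => (hη.memLp (f i)).const_mul _
  have h0 : ∫ ω, ∑ i, x i * η (f i) ω ∂P = 0 := by
    rw [integral_finsetSum _ fun i _ => ((hη.memLp _).integrable (by norm_num)).const_mul _]
    simp [integral_const_mul, hη.centred]
  -- Linearity is not an axiom of white noise: it follows because the variance of a combination is
  -- the squared L² norm of the same combination of the `f i`.
  have hz : ∑ i, ∑ j, x i * x j * ∫ ω, η (f i) ω * η (f j) ω ∂P =
      inner ℝ (∑ i, x i • f i) (∑ j, x j • f j) := by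
    simp only [sum_inner, inner_sum, inner_smul_left, inner_smul_right, hη.covariance, mul_assoc,
      conj_trivial]
    refine Finset.sum_congr rfl fun i _ => ?_
    rw [Finset.mul_sum]
    exact Finset.sum_congr rfl fun j _ => by rw [real_inner_comm]
  rw [hz, h, inner_zero_left, variance_of_integral_eq_zero hm.aemeasurable h0] at hv
  have := (integral_eq_zero_iff_of_nonneg (fun ω => sq_nonneg _) hm.integrable_sq).1 hv
  filter_upwards [this] with ω hω
  simpa using hω

lemma sub_ae [IsProbabilityMeasure P] (hη : IsWhiteNoise η P)
    (f g : Lp ℝ 2 (volume : Measure ℝ)) : (fun ω => η f ω - η g ω) =ᵐ[P] η (f - g) := by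
  filter_upwards [hη.sum_ae_eq_zero ![1, -1, -1] ![f, g, f - g]
    (by simp [Fin.sum_univ_three]; abel)] with ω hω
  simp [Fin.sum_univ_three] at hω
  linarith

lemma div_ae [IsProbabilityMeasure P] (hη : IsWhiteNoise η P) (c : ℝ)
    (f : Lp ℝ 2 (volume : Measure ℝ)) : (fun ω => η f ω / c) =ᵐ[P] η (c⁻¹ • f) := by
  filter_upwards [hη.sum_ae_eq_zero ![c⁻¹, -1] ![f, c⁻¹ • f]
    (by simp [Fin.sum_univ_two])] with ω hω
  simp [Fin.sum_univ_two] at hω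
  rw [div_eq_inv_mul]
  linarith

end IsWhiteNoise

end Gaussian

/-! ### Plancherel for Hermitian functions. -/

section Fourier

open ComplexConjugate SchwartzMap

/-- The Schwartz function `x ↦ conj (f (-x))`. -/
def schwartzConjNeg (f : 𝓢(ℝ, ℂ)) : 𝓢(ℝ, ℂ) :=
  SchwartzMap.postcompCLM (Complex.conjCLE : ℂ →L[ℝ] ℂ)
    (SchwartzMap.compCLMOfContinuousLinearEquiv ℝ (ContinuousLinearEquiv.neg ℝ) f)

lemma schwartzConjNeg_apply (f : 𝓢(ℝ, ℂ)) (x : ℝ) : schwartzConjNeg f x = conj (f (-x)) := by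
  simp [schwartzConjNeg]

/-- Conjugation reverses the phase of the Fourier kernel, and the substitution x ↦ -x restores it.
-/
lemma fourier_schwartzConjNeg (f : 𝓢(ℝ, ℂ)) (ξ : ℝ) :
    𝓕 (schwartzConjNeg f) ξ = conj (𝓕 f ξ) := by
  simp only [SchwartzMap.fourier_coe, Real.fourier_real_eq_integral_exp_smul]
  rw [← integral_conj, ← integral_neg_eq_self]
  congr 1
  ext x
  simp only [schwartzConjNeg_apply, smul_eq_mul, map_mul, ← Complex.exp_conj, neg_neg]
  congr 2
  simp [Complex.conj_ofNat]

/-- The real-linear isometry `f ↦ (x ↦ conj (f (-x)))` of `L²`. -/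
def conjNeg (f : Lp ℂ 2 (volume : Measure ℝ)) : Lp ℂ 2 (volume : Measure ℝ) :=
  (Complex.conjCLE : ℂ →L[ℝ] ℂ).compLp
    (Lp.compMeasurePreserving (fun x : ℝ => -x) (Measure.measurePreserving_neg volume) f)

lemma continuous_conjNeg : Continuous conjNeg :=
  ((Complex.conjCLE : ℂ →L[ℝ] ℂ).compLpL 2 volume).continuous.comp
    (Lp.isometry_compMeasurePreserving (Measure.measurePreserving_neg volume)).continuous

lemma coeFn_conjNeg (f : Lp ℂ 2 (volume : Measure ℝ)) :
    conjNeg f =ᵐ[volume] fun x => conj (f (-x)) := by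
  filter_upwards [ContinuousLinearMap.coeFn_compLp (Complex.conjCLE : ℂ →L[ℝ] ℂ)
    (Lp.compMeasurePreserving (fun x : ℝ => -x) (Measure.measurePreserving_neg volume) f),
    Lp.coeFn_compMeasurePreserving f (Measure.measurePreserving_neg (volume : Measure ℝ))]
    with x h1 h2
  rw [conjNeg, h1, h2]
  simp

/-- Both sides are continuous in L², so it is enough to check Schwartz functions, where the
transform is an integral. -/
lemma fourier_conjNeg (f : Lp ℂ 2 (volume : Measure ℝ)) :
    𝓕 (conjNeg f) = (Complex.conjCLE : ℂ →L[ℝ] ℂ).compLp (𝓕 f) := by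
  refine DenseRange.induction_on (p := fun f => 𝓕 (conjNeg f) =
      (Complex.conjCLE : ℂ →L[ℝ] ℂ).compLp (𝓕 f))
    (SchwartzMap.denseRange_toLpCLM (p := 2) (μ := (volume : Measure ℝ)) (F := ℂ)
      ENNReal.ofNat_ne_top) f ?_ ?_
  · refine isClosed_eq ((Lp.fourierTransformₗᵢ ℝ ℂ).continuous.comp continuous_conjNeg)
      (((Complex.conjCLE : ℂ →L[ℝ] ℂ).compLpL 2 volume).continuous.comp
      (Lp.fourierTransformₗᵢ ℝ ℂ).continuous)
  · intro φ
    simp only [SchwartzMap.toLpCLM_apply]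
    have h1 : conjNeg (φ.toLp 2) = (schwartzConjNeg φ).toLp 2 := by
      apply Lp.ext
      have h := (Measure.measurePreserving_neg (volume : Measure ℝ)).quasiMeasurePreserving.ae_eq_comp
        (φ.coeFn_toLp 2 volume)
      filter_upwards [coeFn_conjNeg (φ.toLp 2), (schwartzConjNeg φ).coeFn_toLp 2 volume, h]
        with x h1 h2 h3
      rw [h1, h2, schwartzConjNeg_apply]
      simp only [Function.comp_apply] at h3
      rw [h3]
    rw [h1, SchwartzMap.toLp_fourier_eq, SchwartzMap.toLp_fourier_eq]
    apply Lp.ext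
    filter_upwards [ContinuousLinearMap.coeFn_compLp (Complex.conjCLE : ℂ →L[ℝ] ℂ)
      ((𝓕 φ).toLp 2 volume), (𝓕 φ).coeFn_toLp 2 volume,
      (𝓕 (schwartzConjNeg φ)).coeFn_toLp 2 volume] with x h1 h2 h3
    rw [h1, h2, h3, fourier_schwartzConjNeg]
    simp

/-- Square integrable functions with the Hermitian symmetry of the Fourier transform of a real
function. -/
structure IsSpectral (f : ℝ → ℂ) : Prop where
  memLp : MemLp f 2 volume
  hermitian : ∀ k, f (-k) = conj (f k)

/-- The real part of the angular Fourier transform. -/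
def spectralRe (f : ℝ → ℂ) : Lp ℝ 2 (volume : Measure ℝ) :=
  Complex.reCLM.compLp (angularFourier f)

lemma memLp_comp_two_pi_mul {f : ℝ → ℂ} (hf : MemLp f 2 volume) :
    MemLp (fun m : ℝ => (Real.sqrt (2 * Real.pi) : ℂ) * f (2 * Real.pi * m)) 2 volume := by
  refine MemLp.const_mul ?_ _
  have h0 : (2 * Real.pi) ≠ 0 := by positivity
  have hm : Measure.map (fun m : ℝ => 2 * Real.pi * m) volume =
      ENNReal.ofReal |(2 * Real.pi)⁻¹| • volume := Real.map_volume_mul_left h0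
  have hf' : MemLp f 2 (Measure.map (fun m : ℝ => 2 * Real.pi * m) volume) := by
    rw [hm]
    exact hf.smul_measure ENNReal.ofReal_ne_top
  exact hf'.comp_of_map (by fun_prop)

lemma angularFourier_of_memLp {f : ℝ → ℂ} (hf : MemLp f 2 volume) :
    angularFourier f = 𝓕 ((memLp_comp_two_pi_mul hf).toLp) := by
  rw [angularFourier, dif_pos (memLp_comp_two_pi_mul hf)]

/-- The two factors (2π)^(1/2) in the normalisation cancel the Jacobian of k = 2πm, so Plancherel
holds without a constant. -/
lemma inner_angularFourier {f g : ℝ → ℂ} (hf : MemLp f 2 volume) (hg : MemLp g 2 volume) :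
    inner ℂ (angularFourier f) (angularFourier g) = ∫ k, conj (f k) * g k := by
  rw [angularFourier_of_memLp hf, angularFourier_of_memLp hg, Lp.inner_fourier_eq, L2.inner_def]
  have h0 : (0:ℝ) < 2 * Real.pi := by positivity
  have h : ∀ᵐ m : ℝ, inner ℂ ((memLp_comp_two_pi_mul hf).toLp _ m)
      ((memLp_comp_two_pi_mul hg).toLp _ m) =
      (2 * Real.pi) • (fun k => conj (f k) * g k) (2 * Real.pi * m) := by
    filter_upwards [(memLp_comp_two_pi_mul hf).coeFn_toLp, (memLp_comp_two_pi_mul hg).coeFn_toLp]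
      with m h1 h2
    rw [h1, h2]
    have : (Real.sqrt (2 * Real.pi) : ℂ) * (Real.sqrt (2 * Real.pi) : ℂ) =
        ((2 * Real.pi : ℝ) : ℂ) := by
      rw [← Complex.ofReal_mul, Real.mul_self_sqrt h0.le]
    simp only [RCLike.inner_apply, map_mul, Complex.conj_ofReal, Complex.real_smul, ← this]
    ring
  rw [integral_congr_ae h, integral_smul,
    Measure.integral_comp_mul_left (fun k => conj (f k) * g k), smul_smul, abs_of_pos (by positivity),
    mul_inv_cancel₀ h0.ne', one_smul]

/-- Hermitian symmetry makes the rescaled function a fixed point of `conjNeg`, so its transform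
equals its own conjugate. -/
lemma IsSpectral.im_angularFourier {f : ℝ → ℂ} (hf : IsSpectral f) :
    ∀ᵐ x, (angularFourier f x).im = 0 := by
  have h1 : conjNeg ((memLp_comp_two_pi_mul hf.memLp).toLp) =
      (memLp_comp_two_pi_mul hf.memLp).toLp := by
    apply Lp.ext
    have h := (Measure.measurePreserving_neg (volume : Measure ℝ)).quasiMeasurePreserving.ae_eq_comp
        (memLp_comp_two_pi_mul hf.memLp).coeFn_toLp
    filter_upwards [coeFn_conjNeg ((memLp_comp_two_pi_mul hf.memLp).toLp), h,
      (memLp_comp_two_pi_mul hf.memLp).coeFn_toLp] with x h1 h2 h3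
    simp only [Function.comp_apply] at h2
    rw [h1, h2, h3]
    simp [hf.hermitian]
  have h2 := fourier_conjNeg ((memLp_comp_two_pi_mul hf.memLp).toLp)
  rw [h1] at h2
  have h3 := ContinuousLinearMap.coeFn_compLp (Complex.conjCLE : ℂ →L[ℝ] ℂ)
    (𝓕 ((memLp_comp_two_pi_mul hf.memLp).toLp))
  rw [← h2] at h3
  rw [angularFourier_of_memLp hf.memLp]
  filter_upwards [h3] with x hx
  exact Complex.conj_eq_iff_im.1 (by simpa using hx.symm)

/-- Plancherel's identity for the real Fourier transforms of Hermitian functions. -/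
lemma inner_spectralRe {f g : ℝ → ℂ} (hf : IsSpectral f) (hg : IsSpectral g) :
    inner ℝ (spectralRe f) (spectralRe g) = (∫ k, conj (f k) * g k).re := by
  rw [← inner_angularFourier hf.memLp hg.memLp, L2.inner_def, L2.inner_def]
  have h : ∀ᵐ x, inner ℂ (angularFourier f x) (angularFourier g x) =
      ((inner ℝ (spectralRe f x) (spectralRe g x) : ℝ) : ℂ) := by
    filter_upwards [hf.im_angularFourier, hg.im_angularFourier,
      Complex.reCLM.coeFn_compLp (angularFourier f),
      Complex.reCLM.coeFn_compLp (angularFourier g)] with x h1 h2 h3 h4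
    rw [spectralRe, spectralRe, h3, h4]
    apply Complex.ext <;> simp [h1, h2]
  rw [integral_congr_ae h, integral_complex_ofReal, Complex.ofReal_re]

/-- Square integrability is what excludes the default value 0 of `angularFourier`, for which
additivity could fail. -/
lemma spectralRe_sub {f g : ℝ → ℂ} (hf : MemLp f 2 volume) (hg : MemLp g 2 volume) :
    spectralRe (fun k => f k - g k) = spectralRe f - spectralRe g := by
  have h : angularFourier (fun k => f k - g k) = angularFourier f - angularFourier g := by
    rw [angularFourier_of_memLp hf, angularFourier_of_memLp hg,
      angularFourier_of_memLp (f := fun k => f k - g k) (hf.sub hg)]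
    refine Eq.trans ?_ ((Lp.fourierTransformₗᵢ ℝ ℂ).map_sub _ _)
    rw [← MemLp.toLp_sub]
    refine congrArg (Lp.fourierTransformₗᵢ ℝ ℂ) ?_
    apply MemLp.toLp_congr
    exact Eventually.of_forall fun x => by simp [mul_sub]
  rw [spectralRe, h]
  exact map_sub (Complex.reCLM.compLpL 2 volume) _ _

end Fourier

/-! ### The constant c as an explicit integral. -/

section Constant

open Set

lemma lintegral_rpow_mul_exp_neg_mul {a r : ℝ} (ha : 0 < a) (hr : 0 < r) :
    ∫⁻ y in Ioi (0 : ℝ), ENNReal.ofReal (y ^ (a - 1) * Real.exp (-(r * y))) =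
      ENNReal.ofReal (r ^ (-a) * Real.Gamma a) := by
  have h := Real.integral_rpow_mul_exp_neg_mul_Ioi ha hr
  have hi : IntegrableOn (fun y : ℝ => y ^ (a - 1) * Real.exp (-(r * y))) (Ioi 0) := by
    -- A non-integrable function would have Bochner integral 0, but the Gamma value is positive.
    by_contra hc
    rw [integral_undef hc] at h
    have : 0 < (1 / r) ^ a * Real.Gamma a := mul_pos (by positivity) (Real.Gamma_pos_of_pos ha)
    exact this.ne h
  rw [← ofReal_integral_eq_lintegral_ofReal hi, h]
  · rw [one_div, Real.inv_rpow hr.le, Real.rpow_neg hr.le]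
  · filter_upwards [ae_restrict_mem measurableSet_Ioi] with y hy
    have : (0:ℝ) < y := hy
    positivity

lemma integrable_cos_mul_gaussian {y : ℝ} (hy : 0 < y) :
    Integrable (fun x : ℝ => Real.cos x * Real.exp (-y * x ^ 2)) := by
  refine (integrable_exp_neg_mul_sq hy).bdd_mul (c := 1)
    Real.continuous_cos.aestronglyMeasurable ?_
  exact Eventually.of_forall fun x => by simpa using Real.abs_cos_le_one x

/-- This is the real part of the Fourier transform of a Gaussian at frequency 1. -/
lemma integral_cos_mul_gaussian {y : ℝ} (hy : 0 < y) :
    ∫ x : ℝ, Real.cos x * Real.exp (-y * x ^ 2) =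
      Real.sqrt (Real.pi / y) * Real.exp (-1 / (4 * y)) := by
  have h := fourierIntegral_gaussian (b := (y : ℂ)) (by simpa using hy) 1
  have h1 : ∀ x : ℝ, Complex.exp (Complex.I * 1 * x) * Complex.exp (-(y : ℂ) * x ^ 2) =
      ((Real.cos x * Real.exp (-y * x ^ 2) : ℝ) : ℂ) +
        ((Real.sin x * Real.exp (-y * x ^ 2) : ℝ) : ℂ) * Complex.I := fun x => by
    rw [mul_one, mul_comm Complex.I, Complex.exp_mul_I]
    push_cast
    ring
  have hs : Integrable (fun x : ℝ => Real.sin x * Real.exp (-y * x ^ 2)) := by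
    refine (integrable_exp_neg_mul_sq hy).bdd_mul (c := 1)
      Real.continuous_sin.aestronglyMeasurable ?_
    exact Eventually.of_forall fun x => by simpa using Real.abs_sin_le_one x
  simp_rw [h1] at h
  rw [integral_add (integrable_cos_mul_gaussian hy).ofReal (hs.ofReal.mul_const _),
    integral_mul_const, integral_complex_ofReal, integral_complex_ofReal] at h
  have h2 := congrArg Complex.re h
  have h3 : ((Real.pi : ℂ) / y) ^ (1 / 2 : ℂ) = ((Real.sqrt (Real.pi / y) : ℝ) : ℂ) := by
    rw [Real.sqrt_eq_rpow, Complex.ofReal_cpow (by positivity)]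
    push_cast
    rfl
  have h4 : Complex.exp (-(1 : ℂ) ^ 2 / (4 * y)) = ((Real.exp (-1 / (4 * y)) : ℝ) : ℂ) := by
    push_cast
    simp
  rw [h3, h4, ← Complex.ofReal_mul, Complex.ofReal_re] at h2
  simpa using h2

lemma lintegral_one_sub_cos_mul_gaussian {y : ℝ} (hy : 0 < y) :
    ∫⁻ x : ℝ, ENNReal.ofReal ((1 - Real.cos x) * Real.exp (-(x ^ 2 * y))) =
      ENNReal.ofReal (Real.sqrt (Real.pi / y) * (1 - Real.exp (-(1 / (4 * y))))) := by
  have h1 : (fun x : ℝ => (1 - Real.cos x) * Real.exp (-(x ^ 2 * y))) =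
      fun x => Real.exp (-y * x ^ 2) - Real.cos x * Real.exp (-y * x ^ 2) := by
    ext x
    rw [show -(x ^ 2 * y) = -y * x ^ 2 by ring]
    ring
  have hi := (integrable_exp_neg_mul_sq hy).sub (integrable_cos_mul_gaussian hy)
  rw [← ofReal_integral_eq_lintegral_ofReal (by rw [h1]; exact hi)]
  · rw [h1, integral_sub (integrable_exp_neg_mul_sq hy) (integrable_cos_mul_gaussian hy),
      integral_gaussian, integral_cos_mul_gaussian hy]
    congr 1
    rw [neg_div]
    ring
  · exact Eventually.of_forall fun x =>
      mul_nonneg (by linarith [Real.cos_le_one x]) (Real.exp_pos _).le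

lemma lintegral_Ioo_exp_neg {b : ℝ} (hb : 0 < b) :
    ∫⁻ w in Ioo 0 b, ENNReal.ofReal (Real.exp (-w)) = ENNReal.ofReal (1 - Real.exp (-b)) := by
  have hi : IntervalIntegrable (fun w : ℝ => Real.exp (-w)) volume 0 b :=
    Continuous.intervalIntegrable (by fun_prop) _ _
  rw [restrict_Ioo_eq_restrict_Ioc, ← ofReal_integral_eq_lintegral_ofReal hi.1
    (Eventually.of_forall fun w => (Real.exp_pos _).le), ← intervalIntegral.integral_of_le hb.le]
  congr 1
  rw [intervalIntegral.integral_comp_neg (fun w => Real.exp w)]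
  simp

lemma lintegral_Ioo_rpow {b r : ℝ} (hb : 0 < b) (hr : 0 < r) :
    ∫⁻ y in Ioo 0 b, ENNReal.ofReal (y ^ (r - 1)) = ENNReal.ofReal (b ^ r / r) := by
  have hi : IntervalIntegrable (fun y : ℝ => y ^ (r - 1)) volume 0 b :=
    intervalIntegral.intervalIntegrable_rpow' (by linarith)
  rw [restrict_Ioo_eq_restrict_Ioc, ← ofReal_integral_eq_lintegral_ofReal hi.1,
    ← intervalIntegral.integral_of_le hb.le, integral_rpow (Or.inl (by linarith))]
  · simp [Real.zero_rpow hr.ne']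
  · filter_upwards [ae_restrict_mem measurableSet_Ioc] with y hy
    exact Real.rpow_nonneg hy.1.le _

lemma setLIntegral_indicator_Ioi {f : ℝ → ℝ≥0∞} {b : ℝ} :
    ∫⁻ w in Ioi (0 : ℝ), (Iio b).indicator f w = ∫⁻ w in Ioo 0 b, f w := by
  rw [setLIntegral_indicator measurableSet_Iio, inter_comm, Ioi_inter_Iio]

/-- Write 1 - e^(-b) as the integral of e^(-w) over 0 < w < b with b = 1/(4y), and apply Tonelli on
the region 4yw < 1. The inner y-integral is a power of w, which leaves a Gamma integral at 3/2 - a.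
-/
lemma lintegral_rpow_mul_one_sub_exp {a : ℝ} (ha : 1 / 2 < a) (ha' : a < 3 / 2) :
    ∫⁻ y in Ioi (0 : ℝ), ENNReal.ofReal (y ^ (a - 3 / 2) * (1 - Real.exp (-(1 / (4 * y))))) =
      ENNReal.ofReal (4 ^ (1 / 2 - a) * -Real.Gamma (1 / 2 - a)) := by
  let F : ℝ → ℝ → ℝ≥0∞ := fun y w => {p : ℝ × ℝ | 4 * p.1 * p.2 < 1}.indicator
    (fun p => ENNReal.ofReal (p.1 ^ (a - 3 / 2)) * ENNReal.ofReal (Real.exp (-p.2))) (y, w)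
  have hF : Measurable (Function.uncurry F) := by
    refine Measurable.indicator (by fun_prop) ?_
    exact measurableSet_lt (by fun_prop) (by fun_prop)
  have h1 : ∀ y ∈ Ioi (0 : ℝ), ∫⁻ w in Ioi (0 : ℝ), F y w =
      ENNReal.ofReal (y ^ (a - 3 / 2) * (1 - Real.exp (-(1 / (4 * y))))) := by
    intro y hy
    have hy : 0 < y := hy
    have : F y = (Iio (1 / (4 * y))).indicator
        fun w => ENNReal.ofReal (y ^ (a - 3 / 2)) * ENNReal.ofReal (Real.exp (-w)) := by
      ext w
      simp only [F, indicator, mem_ofPred_eq, mem_Iio, lt_div_iff₀ (show 0 < 4 * y by positivity)]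
      rw [mul_comm w]
    rw [this, setLIntegral_indicator_Ioi, lintegral_const_mul _ (by fun_prop),
      lintegral_Ioo_exp_neg (by positivity), ENNReal.ofReal_mul (by positivity)]
  have h2 : ∀ w ∈ Ioi (0 : ℝ), ∫⁻ y in Ioi (0 : ℝ), F y w =
      ENNReal.ofReal (4 ^ (1 / 2 - a) / (a - 1 / 2)) *
        ENNReal.ofReal (w ^ ((3 / 2 - a) - 1) * Real.exp (-(1 * w))) := by
    intro w hw
    have hw : 0 < w := hw
    have : (fun y => F y w) = (Iio (1 / (4 * w))).indicator
        fun y => ENNReal.ofReal (y ^ ((a - 1 / 2) - 1)) * ENNReal.ofReal (Real.exp (-w)) := by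
      ext y
      simp only [F, indicator, mem_ofPred_eq, mem_Iio, lt_div_iff₀ (show 0 < 4 * w by positivity)]
      rw [show a - 1 / 2 - 1 = a - 3 / 2 by ring, show y * (4 * w) = 4 * y * w by ring]
    rw [this, setLIntegral_indicator_Ioi, lintegral_mul_const _ (by fun_prop),
      lintegral_Ioo_rpow (by positivity) (by linarith),
      ← ENNReal.ofReal_mul (by have : 0 ≤ a - 1 / 2 := by linarith
                               positivity),
      ← ENNReal.ofReal_mul (by have : 0 ≤ a - 1 / 2 := by linarith
                               positivity)]
    congr 1
    rw [one_div, Real.inv_rpow (by positivity), Real.mul_rpow (by norm_num) hw.le,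
      show (1 / 2 - a) = -(a - 1 / 2) by ring, show 3 / 2 - a - 1 = -(a - 1 / 2) by ring,
      Real.rpow_neg hw.le, Real.rpow_neg (by norm_num : (0:ℝ) ≤ 4), mul_inv, one_mul]
    ring
  rw [← setLIntegral_congr_fun measurableSet_Ioi h1, lintegral_lintegral_swap hF.aemeasurable,
    setLIntegral_congr_fun measurableSet_Ioi h2, lintegral_const_mul _ (by fun_prop),
    lintegral_rpow_mul_exp_neg_mul (by linarith) one_pos, ← ENNReal.ofReal_mul
      (by have : 0 ≤ a - 1 / 2 := by linarith
          positivity)]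
  congr 1
  -- The functional equation gives Γ(3/2 - a) = (1/2 - a)Γ(1/2 - a), whose factor cancels the
  -- denominator a - 1/2 and leaves the minus sign.
  rw [Real.one_rpow, one_mul, show 3 / 2 - a = (1 / 2 - a) + 1 by ring,
    Real.Gamma_add_one (by linarith : 1 / 2 - a ≠ 0)]
  have : a - 1 / 2 ≠ 0 := by linarith
  rw [div_mul_eq_mul_div, div_eq_iff this]
  ring

lemma gamma_neg {s : ℝ} (h1 : -1 < s) (h0 : s < 0) : Real.Gamma s < 0 := by
  have h := Real.Gamma_add_one h0.ne
  have := Real.Gamma_pos_of_pos (show 0 < s + 1 by linarith)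
  rw [h] at this
  nlinarith

lemma tangentConst_pos {a : ℝ} (ha : 1 / 2 < a) (ha' : a < 3 / 2) : 0 < tangentConst a := by
  have h1 := gamma_neg (show -1 < 1 / 2 - a by linarith) (by linarith)
  have h2 := Real.Gamma_pos_of_pos (show 0 < a by linarith)
  rw [tangentConst]
  have := Real.pi_pos
  apply div_pos (by linarith)
  positivity

/-- Subordination: |x|^(-2a) is Γ(a)⁻¹ times the integral of y^(a-1) e^(-x²y) over y > 0. Tonelli
reduces the x-integral to a Gaussian one. Working with nonnegative integrals makes finiteness, hence
integrability, part of the result. -/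
lemma lintegral_one_sub_cos_mul_rpow {a : ℝ} (ha : 1 / 2 < a) (ha' : a < 3 / 2) :
    ∫⁻ x : ℝ, ENNReal.ofReal ((1 - Real.cos x) * |x| ^ (-2 * a)) =
      ENNReal.ofReal (Real.pi * tangentConst a) := by
  have ha0 : 0 < a := by linarith
  have hG := Real.Gamma_pos_of_pos ha0
  have hc : ∀ x, 0 ≤ 1 - Real.cos x := fun x => by linarith [Real.cos_le_one x]
  let F : ℝ → ℝ → ℝ≥0∞ := fun x y => ENNReal.ofReal (Real.Gamma a)⁻¹ * (ENNReal.ofReal (y ^ (a - 1)) *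
    ENNReal.ofReal ((1 - Real.cos x) * Real.exp (-(x ^ 2 * y))))
  have h1 : ∀ᵐ x : ℝ, ENNReal.ofReal ((1 - Real.cos x) * |x| ^ (-2 * a)) =
      ∫⁻ y in Ioi (0 : ℝ), F x y := by
    filter_upwards [Measure.ae_ne volume (0 : ℝ)] with x hx
    have hx2 : 0 < x ^ 2 := by positivity
    have hxa : |x| ^ (-2 * a) = (x ^ 2) ^ (-a) := by
      rw [← sq_abs, ← Real.rpow_natCast, ← Real.rpow_mul (abs_nonneg x)]
      norm_num
    have : ∀ y ∈ Ioi (0 : ℝ), F x y = ENNReal.ofReal ((Real.Gamma a)⁻¹ * (1 - Real.cos x)) *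
        ENNReal.ofReal (y ^ (a - 1) * Real.exp (-(x ^ 2 * y))) := by
      intro y hy
      have hy : 0 < y := hy
      simp only [F]
      have := hc x
      rw [← ENNReal.ofReal_mul (by positivity), ← ENNReal.ofReal_mul (by positivity),
        ← ENNReal.ofReal_mul (by positivity)]
      congr 1
      ring
    have hcx := hc x
    rw [setLIntegral_congr_fun measurableSet_Ioi this, lintegral_const_mul _ (by fun_prop),
      lintegral_rpow_mul_exp_neg_mul ha0 hx2, ← ENNReal.ofReal_mul (by positivity), hxa]
    congr 1
    field_simp
  have h2 : ∀ y ∈ Ioi (0 : ℝ), ∫⁻ x, F x y = ENNReal.ofReal ((Real.Gamma a)⁻¹ * Real.sqrt Real.pi) *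
      ENNReal.ofReal (y ^ (a - 3 / 2) * (1 - Real.exp (-(1 / (4 * y))))) := by
    intro y hy
    have hy : 0 < y := hy
    simp only [F]
    rw [lintegral_const_mul _ (by fun_prop), lintegral_const_mul _ (by fun_prop),
      lintegral_one_sub_cos_mul_gaussian hy, ← ENNReal.ofReal_mul (by positivity),
      ← ENNReal.ofReal_mul (by positivity), ← ENNReal.ofReal_mul (by positivity)]
    congr 1
    rw [Real.sqrt_div Real.pi_pos.le, show a - 3 / 2 = (a - 1) - 1 / 2 by ring,
      Real.rpow_sub hy (a - 1), ← Real.sqrt_eq_rpow]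
    ring
  have hF : Measurable (Function.uncurry F) := by
    simp only [F, Function.uncurry_def]
    fun_prop
  rw [lintegral_congr_ae h1, lintegral_lintegral_swap hF.aemeasurable,
    setLIntegral_congr_fun measurableSet_Ioi h2, lintegral_const_mul _ (by fun_prop),
    lintegral_rpow_mul_one_sub_exp ha ha', ← ENNReal.ofReal_mul (by positivity)]
  congr 1
  rw [tangentConst, show (1 / 2 - a) = -(a - 1 / 2) by ring,
    Real.rpow_neg (by norm_num : (0:ℝ) ≤ 4), show (4 : ℝ) = 2 ^ (2 : ℝ) by norm_num,
    ← Real.rpow_mul (by norm_num : (0:ℝ) ≤ 2), show 2 * (a - 1 / 2) = 2 * a - 1 by ring]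
  have hpi : Real.sqrt Real.pi ≠ 0 := by positivity
  have h2 : (2:ℝ) ^ (2 * a - 1) ≠ 0 := by positivity
  field_simp
  rw [Real.sq_sqrt Real.pi_pos.le]
  ring

lemma measurable_one_sub_cos_mul_rpow (a u : ℝ) :
    Measurable fun x : ℝ => (1 - Real.cos (x * u)) * |x| ^ (-2 * a) := by fun_prop

lemma integrable_one_sub_cos_mul_rpow {a : ℝ} (ha : 1 / 2 < a) (ha' : a < 3 / 2) :
    Integrable fun x : ℝ => (1 - Real.cos x) * |x| ^ (-2 * a) := by
  refine ⟨by simpa using (measurable_one_sub_cos_mul_rpow a 1).aestronglyMeasurable, ?_⟩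
  rw [hasFiniteIntegral_iff_ofReal, lintegral_one_sub_cos_mul_rpow ha ha']
  · exact ENNReal.ofReal_lt_top
  · exact Eventually.of_forall fun x =>
      mul_nonneg (by linarith [Real.cos_le_one x]) (by positivity)

lemma integral_one_sub_cos_mul_rpow {a : ℝ} (ha : 1 / 2 < a) (ha' : a < 3 / 2) :
    ∫ x : ℝ, (1 - Real.cos x) * |x| ^ (-2 * a) = Real.pi * tangentConst a := by
  rw [integral_eq_lintegral_of_nonneg_ae, lintegral_one_sub_cos_mul_rpow ha ha',
    ENNReal.toReal_ofReal]
  · exact mul_nonneg Real.pi_pos.le (tangentConst_pos ha ha').le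
  · exact Eventually.of_forall fun x =>
      mul_nonneg (by linarith [Real.cos_le_one x]) (by positivity)
  · exact (integrable_one_sub_cos_mul_rpow ha ha').1

/-- Homogeneity of the power reduces general u to u = 1; the Jacobian then lowers the exponent 2a to
2a - 1. -/
lemma one_sub_cos_mul_rpow_eq (a : ℝ) {u : ℝ} (hu : u ≠ 0) :
    (fun x : ℝ => (1 - Real.cos (x * u)) * |x| ^ (-2 * a)) =
      fun x => |u| ^ (2 * a) * (fun z => (1 - Real.cos z) * |z| ^ (-2 * a)) (x * u) := by
  ext x
  have : |u| ^ (2 * a) ≠ 0 := by positivity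
  simp only [abs_mul, neg_mul]
  rw [Real.mul_rpow (abs_nonneg _) (abs_nonneg _), Real.rpow_neg (abs_nonneg u)]
  field_simp

lemma integrable_one_sub_cos_mul_mul_rpow {a : ℝ} (ha : 1 / 2 < a) (ha' : a < 3 / 2) (u : ℝ) :
    Integrable fun x : ℝ => (1 - Real.cos (x * u)) * |x| ^ (-2 * a) := by
  rcases eq_or_ne u 0 with rfl | hu
  · simp
  · rw [one_sub_cos_mul_rpow_eq a hu]
    exact ((integrable_one_sub_cos_mul_rpow ha ha').comp_mul_right' hu).const_mul _

lemma integral_one_sub_cos_mul_mul_rpow {a : ℝ} (ha : 1 / 2 < a) (ha' : a < 3 / 2) (u : ℝ) :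
    ∫ x : ℝ, (1 - Real.cos (x * u)) * |x| ^ (-2 * a) =
      Real.pi * tangentConst a * |u| ^ (2 * a - 1) := by
  rcases eq_or_ne u 0 with rfl | hu
  · simp [Real.zero_rpow (show 2 * a - 1 ≠ 0 by linarith)]
  · have hu' : 0 < |u| := abs_pos.2 hu
    rw [one_sub_cos_mul_rpow_eq a hu, integral_const_mul, Measure.integral_comp_mul_right
      (fun z => (1 - Real.cos z) * |z| ^ (-2 * a)), integral_one_sub_cos_mul_rpow ha ha',
      Real.rpow_sub_one hu'.ne', abs_inv, smul_eq_mul]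
    ring

end Constant

/-! ### Spectral kernels and their increments. -/

section Kernels

open ComplexConjugate

/-- The spectral kernel of `Y`. -/
def kernel (lam a s : ℝ) (k : ℝ) : ℂ :=
  ((Real.sqrt (2 * Real.pi))⁻¹ : ℂ) *
    (Complex.exp (Complex.I * k * s) * (((k ^ 2 + lam ^ 2) ^ (-a / 2) : ℝ) : ℂ))

/-- The increment over `[s', s]` of the spectral kernel with weight `w`. -/
def incrKernel (w : ℝ → ℝ) (s s' : ℝ) (k : ℝ) : ℂ :=
  ((Real.sqrt (2 * Real.pi))⁻¹ : ℂ) *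
    ((Complex.exp (Complex.I * k * s) - Complex.exp (Complex.I * k * s')) * (w k : ℂ))

lemma kernel_sub_kernel (lam a s s' : ℝ) :
    (fun k => kernel lam a s k - kernel lam a s' k) =
      incrKernel (fun k => (k ^ 2 + lam ^ 2) ^ (-a / 2)) s s' := by
  ext k
  simp only [kernel, incrKernel]
  ring

lemma exp_I_mul_eq (k s : ℝ) : Complex.exp (Complex.I * k * s) =
    (Real.cos (k * s) : ℂ) + (Real.sin (k * s) : ℂ) * Complex.I := by
  rw [mul_assoc, mul_comm, ← Complex.ofReal_mul, Complex.exp_mul_I]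
  push_cast
  rfl

lemma conj_exp_I_mul (k s : ℝ) : conj (Complex.exp (Complex.I * k * s)) =
    Complex.exp (Complex.I * (-k : ℝ) * s) := by
  rw [← Complex.exp_conj]
  simp

lemma sqrt_two_pi_inv_mul_self : (Real.sqrt (2 * Real.pi))⁻¹ * (Real.sqrt (2 * Real.pi))⁻¹ =
    (2 * Real.pi)⁻¹ := by
  rw [← mul_inv, Real.mul_self_sqrt (by positivity)]

/-- Polarisation: Re (e^(-iku) - 1)(e^(ikv) - 1) = (1 - cos ku) + (1 - cos kv) - (1 - cos k(u-v)).
The base time drops out since |e^(ikt)| = 1, which is the only trigonometric relation used after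
expansion. -/
lemma re_conj_incrKernel_mul (w : ℝ → ℝ) (t u v k : ℝ) :
    (conj (incrKernel w (t + u) t k) * incrKernel w (t + v) t k).re =
      (2 * Real.pi)⁻¹ * ((1 - Real.cos (k * u)) * w k ^ 2 + (1 - Real.cos (k * v)) * w k ^ 2
        - (1 - Real.cos (k * (u - v))) * w k ^ 2) := by
  rw [← sqrt_two_pi_inv_mul_self]
  simp only [incrKernel, exp_I_mul_eq]
  have h0 := Real.sin_sq_add_cos_sq (k * t)
  simp only [mul_add, mul_sub, Real.cos_add, Real.sin_add, Real.cos_sub]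
  generalize Real.sqrt (2 * Real.pi) = r
  generalize Real.cos (k * t) = ct at *
  generalize Real.sin (k * t) = st at *
  generalize Real.cos (k * u) = cu
  generalize Real.sin (k * u) = su
  generalize Real.cos (k * v) = cv
  generalize Real.sin (k * v) = sv
  simp [← Complex.ofReal_inv]
  linear_combination (r⁻¹ ^ 2 * w k ^ 2 * (cu * cv + su * sv - cu - cv + 1)) * h0

lemma norm_sq_incrKernel (w : ℝ → ℝ) (t u k : ℝ) :
    ‖incrKernel w (t + u) t k‖ ^ 2 =
      Real.pi⁻¹ * ((1 - Real.cos (k * u)) * w k ^ 2) := by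
  have h := re_conj_incrKernel_mul w t u u k
  rw [← Complex.normSq_eq_conj_mul_self, Complex.ofReal_re, Complex.normSq_eq_norm_sq] at h
  rw [h, sub_self, mul_zero, Real.cos_zero, mul_inv]
  ring

/-- The weight itself need not be square integrable: the factor 1 - cos compensates the singularity
of |k|^(-a) at 0 in the fractional case. -/
lemma isSpectral_incrKernel {w : ℝ → ℝ} (hw : Measurable w) (heven : ∀ k, w (-k) = w k)
    (hint : ∀ s, Integrable fun k : ℝ => (1 - Real.cos (k * s)) * w k ^ 2) (t u : ℝ) :
    IsSpectral (incrKernel w (t + u) t) where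
  memLp := by
    rw [memLp_two_iff_integrable_sq_norm]
    · simp_rw [norm_sq_incrKernel]
      exact (hint u).const_mul _
    · unfold incrKernel
      fun_prop
  hermitian k := by
    simp only [incrKernel, map_mul, map_sub, conj_exp_I_mul, heven, Complex.conj_ofReal, map_inv₀]

lemma inner_spectralRe_incrKernel {w : ℝ → ℝ} (hw : Measurable w) (heven : ∀ k, w (-k) = w k)
    (hint : ∀ s, Integrable fun k : ℝ => (1 - Real.cos (k * s)) * w k ^ 2) (t u v : ℝ) :
    inner ℝ (spectralRe (incrKernel w (t + u) t)) (spectralRe (incrKernel w (t + v) t)) =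
      (2 * Real.pi)⁻¹ * ((∫ k, (1 - Real.cos (k * u)) * w k ^ 2)
        + (∫ k, (1 - Real.cos (k * v)) * w k ^ 2)
        - ∫ k, (1 - Real.cos (k * (u - v))) * w k ^ 2) := by
  have hu := isSpectral_incrKernel hw heven hint t u
  have hv := isSpectral_incrKernel hw heven hint t v
  rw [inner_spectralRe hu hv]
  have hi : Integrable fun k => conj (incrKernel w (t + u) t k) * incrKernel w (t + v) t k :=
    MemLp.integrable_mul hu.memLp.star hv.memLp
  have h := integral_re hi
  simp only [RCLike.re_eq_complex_re] at h
  rw [← h]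
  simp_rw [re_conj_incrKernel_mul]
  rw [integral_const_mul, integral_sub (f := fun k => (1 - Real.cos (k * u)) * w k ^ 2 +
    (1 - Real.cos (k * v)) * w k ^ 2) ((hint u).add (hint v)) (hint (u - v)),
    integral_add (hint u) (hint v)]

/-! ### The tempered weight: rescaling and dependence on the index. -/

section Weight

variable {lam : ℝ}

lemma continuous_weight (hlam : 0 < lam) (a : ℝ) :
    Continuous fun k : ℝ => (k ^ 2 + lam ^ 2) ^ (-a / 2) :=
  Continuous.rpow_const (by fun_prop) fun k => Or.inl (by positivity)

lemma weight_sq (hlam : 0 < lam) (a k : ℝ) :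
    ((k ^ 2 + lam ^ 2) ^ (-a / 2)) ^ 2 = (k ^ 2 + lam ^ 2) ^ (-a) := by
  rw [← Real.rpow_natCast, ← Real.rpow_mul (by positivity)]
  norm_num

lemma integrable_weight_sq (hlam : 0 < lam) {a : ℝ} (ha : 1 / 2 < a) :
    Integrable fun k : ℝ => (k ^ 2 + lam ^ 2) ^ (-a) := by
  have h := integrable_rpow_neg_one_add_norm_sq (E := ℝ) (μ := volume) (r := 2 * a)
    (by simp; linarith)
  -- Chosen so that m(1 + k²) ≤ k² + λ², which allows comparison with (1 + k²)^(-a).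
  set m := min 1 (lam ^ 2) with hm
  have hm0 : 0 < m := by positivity
  refine (h.const_mul (m ^ (-a))).mono' ?_ (Eventually.of_forall fun k => ?_)
  · exact (Continuous.rpow_const (by fun_prop) fun k => Or.inl (by positivity)).aestronglyMeasurable
  · rw [Real.norm_of_nonneg (by positivity), show -(2 * a) / 2 = -a by ring,
      ← Real.mul_rpow hm0.le (by positivity), Real.norm_eq_abs, sq_abs]
    refine Real.rpow_le_rpow_of_nonpos (by positivity) ?_ (by linarith)
    have h1 : m ≤ 1 := min_le_left _ _
    have h2 : m ≤ lam ^ 2 := min_le_right _ _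
    nlinarith [sq_nonneg k]

lemma memLp_weight (hlam : 0 < lam) {a : ℝ} (ha : 1 / 2 < a) :
    MemLp (fun k : ℝ => (k ^ 2 + lam ^ 2) ^ (-a / 2)) 2 volume := by
  rw [memLp_two_iff_integrable_sq (continuous_weight hlam a).aestronglyMeasurable]
  simp_rw [weight_sq hlam]
  exact integrable_weight_sq hlam ha

lemma integrable_one_sub_cos_mul_weight (hlam : 0 < lam) {a : ℝ} (ha : 1 / 2 < a) (s : ℝ) :
    Integrable fun k : ℝ => (1 - Real.cos (k * s)) * ((k ^ 2 + lam ^ 2) ^ (-a / 2)) ^ 2 := by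
  simp_rw [weight_sq hlam]
  refine (integrable_weight_sq hlam ha).bdd_mul (c := 2) (by fun_prop)
    (Eventually.of_forall fun k => ?_)
  rw [Real.norm_eq_abs, abs_le]
  constructor <;> linarith [Real.cos_le_one (k * s), Real.neg_one_le_cos (k * s)]

lemma isSpectral_kernel (hlam : 0 < lam) {a : ℝ} (ha : 1 / 2 < a) (s : ℝ) :
    IsSpectral (kernel lam a s) where
  memLp := by
    refine (memLp_weight hlam ha).of_le_mul (c := (Real.sqrt (2 * Real.pi))⁻¹) ?_ ?_
    · have := continuous_weight hlam a
      unfold kernel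
      exact Continuous.aestronglyMeasurable (by fun_prop)
    · refine Eventually.of_forall fun k => ?_
      have : ‖Complex.exp (Complex.I * k * s)‖ = 1 := by
        rw [mul_assoc, mul_comm, ← Complex.ofReal_mul, Complex.norm_exp_ofReal_mul_I]
      rw [kernel, norm_mul, norm_mul, this, one_mul, Complex.norm_real, norm_inv,
        Complex.norm_real, Real.norm_of_nonneg (Real.sqrt_nonneg _)]
  hermitian k := by
    simp only [kernel, map_mul, conj_exp_I_mul, Complex.conj_ofReal, map_inv₀, neg_sq]

/-- Rescaling the tempered structure function turns it into that of fractional Brownian motion. -/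
lemma tendsto_rescaled_integral (hlam : 0 < lam) {a : ℝ} (ha : 1 / 2 < a) (ha' : a < 3 / 2)
    (u : ℝ) :
    Tendsto (fun ε : ℝ => (∫ k : ℝ, (1 - Real.cos (k * (ε * u))) * (k ^ 2 + lam ^ 2) ^ (-a)) /
      ε ^ (2 * a - 1)) (𝓝[>] 0) (𝓝 (Real.pi * tangentConst a * |u| ^ (2 * a - 1))) := by
  -- Substituting x = kε turns λ into ελ; the weight contributes ε^(-2a) and the Jacobian one factor
  -- ε.
  have hscale : ∀ ε : ℝ, 0 < ε →
      (∫ k : ℝ, (1 - Real.cos (k * (ε * u))) * (k ^ 2 + lam ^ 2) ^ (-a)) / ε ^ (2 * a - 1) =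
        ∫ x : ℝ, (1 - Real.cos (x * u)) * (x ^ 2 + (ε * lam) ^ 2) ^ (-a) := by
    intro ε hε
    have h := Measure.integral_comp_mul_right
      (fun x : ℝ => (1 - Real.cos (x * u)) * (x ^ 2 + (ε * lam) ^ 2) ^ (-a)) ε
    rw [abs_of_pos (by positivity), smul_eq_mul] at h
    have h2 : ∀ k : ℝ, (1 - Real.cos (k * ε * u)) * ((k * ε) ^ 2 + (ε * lam) ^ 2) ^ (-a) =
        ε ^ (-(2 * a)) * ((1 - Real.cos (k * (ε * u))) * (k ^ 2 + lam ^ 2) ^ (-a)) := by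
      intro k
      rw [show (k * ε) ^ 2 + (ε * lam) ^ 2 = ε ^ 2 * (k ^ 2 + lam ^ 2) by ring,
        Real.mul_rpow (by positivity) (by positivity), ← Real.rpow_natCast ε 2,
        ← Real.rpow_mul hε.le, mul_assoc k]
      push_cast
      rw [mul_neg]
      ring
    simp only [h2] at h
    rw [integral_const_mul, Real.rpow_neg hε.le] at h
    rw [Real.rpow_sub_one hε.ne']
    have h3 : ε ^ (2 * a) ≠ 0 := by positivity
    rw [inv_mul_eq_iff_eq_mul₀ h3] at h
    rw [h]
    generalize (∫ y : ℝ, (1 - Real.cos (y * u)) * (y ^ 2 + (ε * lam) ^ 2) ^ (-a)) = J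
    field_simp
  refine Tendsto.congr' (f₁ := fun ε => ∫ x : ℝ, (1 - Real.cos (x * u)) *
    (x ^ 2 + (ε * lam) ^ 2) ^ (-a)) ?_ ?_
  · filter_upwards [self_mem_nhdsWithin] with ε hε using (hscale ε hε).symm
  rw [← integral_one_sub_cos_mul_mul_rpow ha ha' u]
  -- The integrand with λ = 0 is both the limit and the dominating function, because the exponent -a
  -- is negative.
  refine tendsto_integral_filter_of_dominated_convergence
    (fun x => (1 - Real.cos (x * u)) * |x| ^ (-2 * a)) ?_ ?_
    (integrable_one_sub_cos_mul_mul_rpow ha ha' u) ?_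
  · exact Eventually.of_forall fun ε => Measurable.aestronglyMeasurable (by fun_prop)
  · refine Eventually.of_forall fun ε => ?_
    filter_upwards [Measure.ae_ne volume (0 : ℝ)] with x hx
    have h1 : 0 ≤ 1 - Real.cos (x * u) := by linarith [Real.cos_le_one (x * u)]
    rw [Real.norm_of_nonneg (by positivity)]
    refine mul_le_mul_of_nonneg_left ?_ h1
    rw [show |x| ^ (-2 * a) = (x ^ 2) ^ (-a) by
      rw [← sq_abs, ← Real.rpow_natCast, ← Real.rpow_mul (abs_nonneg x)]; norm_num]
    exact Real.rpow_le_rpow_of_nonpos (by positivity) (by nlinarith [sq_nonneg (ε * lam)])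
      (by linarith)
  · filter_upwards [Measure.ae_ne volume (0 : ℝ)] with x hx
    refine Tendsto.const_mul _ ?_
    rw [show |x| ^ (-2 * a) = (x ^ 2 + (0 * lam) ^ 2) ^ (-a) by
      rw [zero_mul, zero_pow two_ne_zero, add_zero, ← sq_abs, ← Real.rpow_natCast,
        ← Real.rpow_mul (abs_nonneg x)]; norm_num]
    refine Tendsto.mono_left ?_ nhdsWithin_le_nhds
    have hc : ContinuousAt (fun ε : ℝ => (x ^ 2 + (ε * lam) ^ 2) ^ (-a)) 0 :=
      ContinuousAt.rpow_const (by fun_prop) (Or.inl (by simp [hx]))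
    exact hc.tendsto

/-- Convexity replaces the mean value theorem, so that no factor L appears: L will be -log(k² +
λ²)/2, unbounded in k. With r = h/δ, one chord inequality places x + h between x and x + δ, the
other places x between x - δ and x + h. -/
lemma abs_exp_sub_exp_le_of_nonneg {L x h δ : ℝ} (hδ : 0 < δ) (h0 : 0 ≤ h) (hh : h ≤ δ) :
    |Real.exp (L * (x + h)) - Real.exp (L * x)| ≤
      h / δ * (Real.exp (L * (x - δ)) + Real.exp (L * (x + δ))) := by
  have hr0 : 0 ≤ h / δ := by positivity
  have hr1 : h / δ ≤ 1 := (div_le_one hδ).2 hh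
  have hrδ : h / δ * δ = h := div_mul_cancel₀ _ hδ.ne'
  generalize h / δ = r at *
  subst hrδ
  have e1 := convexOn_exp.2 (Set.mem_univ (L * x)) (Set.mem_univ (L * (x + δ)))
    (sub_nonneg.2 hr1) hr0 (by ring)
  have e2 := convexOn_exp.2 (Set.mem_univ (L * (x + r * δ))) (Set.mem_univ (L * (x - δ)))
    (show 0 ≤ 1 / (1 + r) by positivity) (show 0 ≤ r / (1 + r) by positivity) (by field_simp)
  simp only [smul_eq_mul] at e1 e2
  rw [show (1 - r) * (L * x) + r * (L * (x + δ)) = L * (x + r * δ) by ring] at e1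
  rw [show 1 / (1 + r) * (L * (x + r * δ)) + r / (1 + r) * (L * (x - δ)) = L * x by
    field_simp; ring, div_mul_eq_mul_div, div_mul_eq_mul_div, ← add_div,
    le_div_iff₀ (by positivity)] at e2
  have p1 := mul_nonneg hr0 (Real.exp_pos (L * x)).le
  have p2 := mul_nonneg hr0 (Real.exp_pos (L * (x - δ))).le
  have p3 := mul_nonneg hr0 (Real.exp_pos (L * (x + δ))).le
  rw [abs_le]
  constructor <;> linarith

lemma abs_exp_sub_exp_le {L x y δ : ℝ} (hδ : 0 < δ) (h : |y - x| ≤ δ) :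
    |Real.exp (L * y) - Real.exp (L * x)| ≤
      |y - x| / δ * (Real.exp (L * (x - δ)) + Real.exp (L * (x + δ))) := by
  rcases le_total 0 (y - x) with h0 | h0
  · rw [abs_of_nonneg h0] at h ⊢
    have := abs_exp_sub_exp_le_of_nonneg (L := L) (x := x) hδ h0 h
    rwa [add_sub_cancel] at this
  · rw [abs_of_nonpos h0] at h ⊢
    -- Reflecting both L and x reduces a negative increment to a positive one and exchanges x - δ
    -- with x + δ.
    have := abs_exp_sub_exp_le_of_nonneg (L := -L) (x := -x) hδ (neg_nonneg.2 h0) h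
    rw [show -L * (-x + -(y - x)) = L * y by ring, show -L * -x = L * x by ring,
      show -L * (-x - δ) = L * (x + δ) by ring, show -L * (-x + δ) = L * (x - δ) by ring] at this
    rwa [add_comm (Real.exp (L * (x - δ)))]

lemma abs_weight_sub_weight_le (hlam : 0 < lam) {a b δ : ℝ} (hδ : 0 < δ) (h : |b - a| ≤ δ)
    (k : ℝ) :
    |(k ^ 2 + lam ^ 2) ^ (-b / 2) - (k ^ 2 + lam ^ 2) ^ (-a / 2)| ≤
      |b - a| / δ * ((k ^ 2 + lam ^ 2) ^ (-(a - δ) / 2) + (k ^ 2 + lam ^ 2) ^ (-(a + δ) / 2)) := by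
  have hq : 0 < k ^ 2 + lam ^ 2 := by positivity
  have h1 : ∀ x : ℝ, (k ^ 2 + lam ^ 2) ^ (-x / 2) =
      Real.exp ((-Real.log (k ^ 2 + lam ^ 2) / 2) * x) := fun x => by
    rw [Real.rpow_def_of_pos hq]
    congr 1
    ring
  simp only [h1]
  exact abs_exp_sub_exp_le hδ h

/-- The kernel is locally Lipschitz in the index, uniformly in time. -/
lemma exists_norm_spectralRe_kernel_sub_le (hlam : 0 < lam) {a : ℝ} (ha : 1 / 2 < a) :
    ∃ C δ : ℝ, 0 ≤ C ∧ 0 < δ ∧ ∀ b s : ℝ, 1 / 2 < b → |b - a| ≤ δ →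
      ‖spectralRe (kernel lam b s) - spectralRe (kernel lam a s)‖ ≤ C * |b - a| := by
  -- Half the distance from a to 1/2, so that a - δ > 1/2 and the dominating weights remain in L².
  set δ := (a - 1 / 2) / 2 with hδ
  have hδ0 : 0 < δ := by rw [hδ]; linarith
  have hm := (memLp_weight hlam (a := a - δ) (by rw [hδ]; linarith)).add
    (memLp_weight hlam (a := a + δ) (by linarith))
  set g : ℝ → ℝ := fun k =>
    (k ^ 2 + lam ^ 2) ^ (-(a - δ) / 2) + (k ^ 2 + lam ^ 2) ^ (-(a + δ) / 2)
  have hm : MemLp g 2 volume := hm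
  refine ⟨δ⁻¹ * Real.sqrt (∫ k, g k ^ 2), δ, by positivity, hδ0, fun b s hb hba => ?_⟩
  have ksp := isSpectral_kernel hlam hb s
  have ksa := isSpectral_kernel hlam ha s
  have hd : IsSpectral fun k => kernel lam b s k - kernel lam a s k :=
    ⟨ksp.memLp.sub ksa.memLp, fun k => by rw [map_sub, ksp.hermitian, ksa.hermitian]⟩
  have hb : ∀ k, ‖kernel lam b s k - kernel lam a s k‖ ≤ |b - a| / δ * g k := by
    intro k
    have h1 : kernel lam b s k - kernel lam a s k = ((Real.sqrt (2 * Real.pi))⁻¹ : ℂ) *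
        (Complex.exp (Complex.I * k * s) *
          (((k ^ 2 + lam ^ 2) ^ (-b / 2) - (k ^ 2 + lam ^ 2) ^ (-a / 2) : ℝ) : ℂ)) := by
      simp only [kernel]
      push_cast
      ring
    have h2 : ‖Complex.exp (Complex.I * k * s)‖ = 1 := by
      rw [mul_assoc, mul_comm, ← Complex.ofReal_mul, Complex.norm_exp_ofReal_mul_I]
    have h3 : (Real.sqrt (2 * Real.pi))⁻¹ ≤ 1 := by
      apply inv_le_one_of_one_le₀
      rw [Real.one_le_sqrt]
      linarith [Real.pi_gt_three]
    rw [h1, norm_mul, norm_mul, h2, one_mul, Complex.norm_real, norm_inv,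
      Complex.norm_real, Real.norm_of_nonneg (Real.sqrt_nonneg _), Real.norm_eq_abs]
    exact (mul_le_of_le_one_left (abs_nonneg _) h3).trans (abs_weight_sub_weight_le hlam hδ0 hba k)
  have hsq : ‖spectralRe (fun k => kernel lam b s k - kernel lam a s k)‖ ^ 2 ≤
      (|b - a| / δ) ^ 2 * ∫ k, g k ^ 2 := by
    rw [← real_inner_self_eq_norm_sq, inner_spectralRe hd hd, ← integral_const_mul]
    simp_rw [← Complex.normSq_eq_conj_mul_self, integral_complex_ofReal, Complex.ofReal_re,
      Complex.normSq_eq_norm_sq]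
    refine integral_mono ((memLp_two_iff_integrable_sq_norm hd.memLp.1).1 hd.memLp)
      (hm.integrable_sq.const_mul _) fun k => ?_
    simp only [← mul_pow]
    exact pow_le_pow_left₀ (norm_nonneg _) (hb k) 2
  rw [← spectralRe_sub ksp.memLp ksa.memLp]
  have hI : 0 ≤ ∫ k, g k ^ 2 := integral_nonneg fun k => sq_nonneg _
  refine abs_le_of_sq_le_sq' ?_ (by positivity) |>.2
  rw [show (δ⁻¹ * Real.sqrt (∫ k, g k ^ 2) * |b - a|) ^ 2 =
    (|b - a| / δ) ^ 2 * Real.sqrt (∫ k, g k ^ 2) ^ 2 by ring, Real.sq_sqrt hI]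
  exact hsq

end Weight

end Kernels

/-! ### Limits of rescaled increments and the tangent process. -/

section TangentProcess

/-- `A` and `B` need not converge in norm; their convergent squared norms bound them, and
Cauchy–Schwarz removes the cross terms with `R` and `S`. -/
lemma tendsto_inner_add {E κ : Type*} [NormedAddCommGroup E] [InnerProductSpace ℝ E]
    {l : Filter κ} {A B R S : κ → E} {p q r : ℝ}
    (hA : Tendsto (fun n => inner ℝ (A n) (A n)) l (𝓝 p))
    (hB : Tendsto (fun n => inner ℝ (B n) (B n)) l (𝓝 q))
    (hAB : Tendsto (fun n => inner ℝ (A n) (B n)) l (𝓝 r))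
    (hR : Tendsto R l (𝓝 0)) (hS : Tendsto S l (𝓝 0)) :
    Tendsto (fun n => inner ℝ (A n + R n) (B n + S n)) l (𝓝 r) := by
  have hnorm : ∀ {A : κ → E} {p : ℝ}, Tendsto (fun n => inner ℝ (A n) (A n)) l (𝓝 p) →
      Tendsto (fun n => ‖A n‖) l (𝓝 (Real.sqrt p)) := fun h => by
    simpa [Function.comp_def, real_inner_self_eq_norm_sq] using
      (Real.continuous_sqrt.tendsto _).comp h
  have hAS : Tendsto (fun n => inner ℝ (A n) (S n)) l (𝓝 0) := by
    refine squeeze_zero_norm (fun n => norm_inner_le_norm (𝕜 := ℝ) (A n) (S n)) ?_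
    simpa using (hnorm hA).mul hS.norm
  have hRB : Tendsto (fun n => inner ℝ (R n) (B n)) l (𝓝 0) := by
    refine squeeze_zero_norm (fun n => norm_inner_le_norm (𝕜 := ℝ) (R n) (B n)) ?_
    simpa using hR.norm.mul (hnorm hB)
  have hRS : Tendsto (fun n => inner ℝ (R n) (S n)) l (𝓝 0) := by
    simpa using hR.inner (𝕜 := ℝ) hS
  simp_rw [inner_add_left, inner_add_right]
  simpa using (hAB.add hAS).add (hRB.add hRS)

/-- The elements of `L²` representing fractional Brownian motion. -/
def fbmElement (a u : ℝ) : Lp ℝ 2 (volume : Measure ℝ) :=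
  spectralRe (incrKernel (fun k => |k| ^ (-a)) (0 + u) 0)

lemma abs_rpow_neg_sq (a k : ℝ) : (|k| ^ (-a)) ^ 2 = |k| ^ (-2 * a) := by
  rw [← Real.rpow_natCast, ← Real.rpow_mul (abs_nonneg k)]
  congr 1
  push_cast
  ring

lemma inner_fbmElement {a : ℝ} (ha : 1 / 2 < a) (ha' : a < 3 / 2) (u v : ℝ) :
    inner ℝ (fbmElement a u) (fbmElement a v) = tangentConst a / 2 *
      (|u| ^ (2 * a - 1) + |v| ^ (2 * a - 1) - |u - v| ^ (2 * a - 1)) := by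
  rw [fbmElement, fbmElement, inner_spectralRe_incrKernel (by fun_prop) (by simp)]
  · simp_rw [abs_rpow_neg_sq, integral_one_sub_cos_mul_mul_rpow ha ha']
    have := Real.pi_ne_zero
    field_simp
  · simp_rw [abs_rpow_neg_sq]
    exact integrable_one_sub_cos_mul_mul_rpow ha ha'

variable {lam : ℝ}

/-- Rescaled increments of the stationary field with constant index. -/
lemma tendsto_inner_rescaled_kernel (hlam : 0 < lam) {a : ℝ} (ha : 1 / 2 < a) (ha' : a < 3 / 2)
    (t u v : ℝ) :
    Tendsto (fun ε : ℝ => inner ℝ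
      ((ε ^ (a - 1 / 2))⁻¹ • (spectralRe (kernel lam a (t + ε * u)) - spectralRe (kernel lam a t)))
      ((ε ^ (a - 1 / 2))⁻¹ • (spectralRe (kernel lam a (t + ε * v)) - spectralRe (kernel lam a t))))
      (𝓝[>] 0) (𝓝 (tangentConst a / 2 *
        (|u| ^ (2 * a - 1) + |v| ^ (2 * a - 1) - |u - v| ^ (2 * a - 1)))) := by
  have h := (((tendsto_rescaled_integral hlam ha ha' u).add
    (tendsto_rescaled_integral hlam ha ha' v)).sub
    (tendsto_rescaled_integral hlam ha ha' (u - v))).const_mul (2 * Real.pi)⁻¹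
  have hl : (2 * Real.pi)⁻¹ * (Real.pi * tangentConst a * |u| ^ (2 * a - 1) +
      Real.pi * tangentConst a * |v| ^ (2 * a - 1) -
      Real.pi * tangentConst a * |u - v| ^ (2 * a - 1)) = tangentConst a / 2 *
        (|u| ^ (2 * a - 1) + |v| ^ (2 * a - 1) - |u - v| ^ (2 * a - 1)) := by
    have := Real.pi_ne_zero
    field_simp
  rw [hl] at h
  refine h.congr' ?_
  filter_upwards [self_mem_nhdsWithin] with ε hε
  have hε : 0 < ε := hε
  have hs : ∀ s, spectralRe (kernel lam a (t + s)) - spectralRe (kernel lam a t) =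
      spectralRe (incrKernel (fun k => (k ^ 2 + lam ^ 2) ^ (-a / 2)) (t + s) t) := fun s => by
    rw [← spectralRe_sub (isSpectral_kernel hlam ha _).memLp (isSpectral_kernel hlam ha _).memLp,
      kernel_sub_kernel]
  rw [hs, hs, real_inner_smul_left, real_inner_smul_right,
    inner_spectralRe_incrKernel (continuous_weight hlam a).measurable (by simp)
      (integrable_one_sub_cos_mul_weight hlam ha)]
  simp_rw [weight_sq hlam]
  have hp : ε ^ (2 * a - 1) = ε ^ (a - 1 / 2) * ε ^ (a - 1 / 2) := by
    rw [← Real.rpow_add hε]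
    congr 1
    ring
  rw [hp, mul_sub ε u v, mul_inv]
  ring

variable {K κ : ℝ≥0} {α : ℝ → ℝ}

/-- The time `x ε` is arbitrary because the Lipschitz bound is uniform in time. It is used at the
moving time t + εu, and at time 0 for the subtracted term. -/
lemma tendsto_rescaled_index_variation (hlam : 0 < lam) (hα : HolderWith K κ α)
    (hbd : ∀ t, 1 / 2 < α t ∧ α t < (κ : ℝ) + 1 / 2) (t u : ℝ) (x : ℝ → ℝ) :
    Tendsto (fun ε : ℝ => (ε ^ (α t - 1 / 2))⁻¹ •
      (spectralRe (kernel lam (α (t + ε * u)) (x ε)) - spectralRe (kernel lam (α t) (x ε))))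
      (𝓝[>] 0) (𝓝 0) := by
  have hκ : (0 : ℝ) < κ := by linarith [(hbd 0).1, (hbd 0).2]
  obtain ⟨C, δ, hC, hδ, h⟩ := exists_norm_spectralRe_kernel_sub_le hlam (hbd t).1
  have hhol : ∀ ε : ℝ, 0 < ε → |α (t + ε * u) - α t| ≤ K * |u| ^ (κ : ℝ) * ε ^ (κ : ℝ) := by
    intro ε hε
    have := hα.dist_le (t + ε * u) t
    rw [Real.dist_eq, Real.dist_eq, add_sub_cancel_left, abs_mul, abs_of_pos hε,
      Real.mul_rpow hε.le (abs_nonneg u)] at this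
    linarith
  have hpow : ∀ b : ℝ, 0 < b → Tendsto (fun ε : ℝ => ε ^ b) (𝓝[>] 0) (𝓝 0) := fun b hb => by
    have := (Real.continuousAt_rpow_const 0 b (Or.inr hb.le)).tendsto
    rw [Real.zero_rpow hb.ne'] at this
    exact this.mono_left nhdsWithin_le_nhds
  have hsmall : ∀ᶠ ε : ℝ in 𝓝[>] 0, K * |u| ^ (κ : ℝ) * ε ^ (κ : ℝ) < δ := by
    have := (hpow κ hκ).const_mul (K * |u| ^ (κ : ℝ))
    rw [mul_zero] at this
    exact this.eventually_lt_const hδ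
  -- The bound α(t) < κ + 1/2 makes this exponent positive: index variation is of smaller order than
  -- ε^H.
  have hz := (hpow (κ - (α t - 1 / 2)) (by linarith [(hbd t).2])).const_mul
    (C * (K * |u| ^ (κ : ℝ)))
  rw [mul_zero] at hz
  refine squeeze_zero_norm' ?_ hz
  filter_upwards [hsmall, self_mem_nhdsWithin] with ε h1 hε
  have hε : 0 < ε := hε
  have h2 := hhol ε hε
  have h3 := h (α (t + ε * u)) (x ε) (hbd _).1 (h2.trans h1.le)
  rw [norm_smul, Real.norm_of_nonneg (by positivity), Real.rpow_sub hε (κ : ℝ), inv_mul_eq_div]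
  calc _ ≤ C * (K * |u| ^ (κ : ℝ) * ε ^ (κ : ℝ)) / ε ^ (α t - 1 / 2) := by
        gcongr
        exact h3.trans (by gcongr)
    _ = _ := by ring

/-- The `L²` elements representing the multifractional process at a fixed time. -/
def ouElement (α : ℝ → ℝ) (lam t : ℝ) : Lp ℝ 2 (volume : Measure ℝ) :=
  spectralRe (kernel lam (α t) t)

/-- The `L²` elements representing tempered multifractional Brownian motion at a fixed time. -/
def mbmElement (α : ℝ → ℝ) (lam t : ℝ) : Lp ℝ 2 (volume : Measure ℝ) :=
  spectralRe (kernel lam (α t) t) - spectralRe (kernel lam (α t) 0)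

lemma tendsto_inner_ouElement (hlam : 0 < lam) (hκ : κ ≤ 1) (hα : HolderWith K κ α)
    (hbd : ∀ t, 1 / 2 < α t ∧ α t < (κ : ℝ) + 1 / 2) (t u v : ℝ) :
    Tendsto (fun ε : ℝ => inner ℝ
      ((ε ^ (α t - 1 / 2))⁻¹ • (ouElement α lam (t + ε * u) - ouElement α lam t))
      ((ε ^ (α t - 1 / 2))⁻¹ • (ouElement α lam (t + ε * v) - ouElement α lam t)))
      (𝓝[>] 0) (𝓝 (tangentConst (α t) / 2 *
        (|u| ^ (2 * α t - 1) + |v| ^ (2 * α t - 1) - |u - v| ^ (2 * α t - 1)))) := by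
  have hκ' : (κ : ℝ) ≤ 1 := by exact_mod_cast hκ
  have ha' : α t < 3 / 2 := by linarith [(hbd t).2]
  have hm := tendsto_inner_rescaled_kernel hlam (hbd t).1 ha' t
  have hr := tendsto_rescaled_index_variation hlam hα hbd t
  -- Split the increment into a move in time at frozen index α(t) and a change of index at the new
  -- time.
  refine (tendsto_inner_add (hm u u) (hm v v) (hm u v) (hr u fun ε => t + ε * u)
    (hr v fun ε => t + ε * v)).congr fun ε => ?_
  have h : ∀ u, (ε ^ (α t - 1 / 2))⁻¹ •
        (spectralRe (kernel lam (α t) (t + ε * u)) - spectralRe (kernel lam (α t) t)) +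
      (ε ^ (α t - 1 / 2))⁻¹ • (spectralRe (kernel lam (α (t + ε * u)) (t + ε * u)) -
        spectralRe (kernel lam (α t) (t + ε * u))) =
      (ε ^ (α t - 1 / 2))⁻¹ • (ouElement α lam (t + ε * u) - ouElement α lam t) := fun u => by
    simp only [ouElement]
    rw [← smul_add]
    congr 1
    abel
  rw [h, h]

lemma tendsto_inner_mbmElement (hlam : 0 < lam) (hκ : κ ≤ 1) (hα : HolderWith K κ α)
    (hbd : ∀ t, 1 / 2 < α t ∧ α t < (κ : ℝ) + 1 / 2) (t u v : ℝ) :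
    Tendsto (fun ε : ℝ => inner ℝ
      ((ε ^ (α t - 1 / 2))⁻¹ • (mbmElement α lam (t + ε * u) - mbmElement α lam t))
      ((ε ^ (α t - 1 / 2))⁻¹ • (mbmElement α lam (t + ε * v) - mbmElement α lam t)))
      (𝓝[>] 0) (𝓝 (tangentConst (α t) / 2 *
        (|u| ^ (2 * α t - 1) + |v| ^ (2 * α t - 1) - |u - v| ^ (2 * α t - 1)))) := by
  have hm := tendsto_inner_ouElement hlam hκ hα hbd t
  have hr := fun u => (tendsto_rescaled_index_variation hlam hα hbd t u fun _ => 0).neg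
  simp only [neg_zero] at hr
  -- The two processes' increments differ only by an index variation at time 0, which is negligible.
  refine (tendsto_inner_add (hm u u) (hm v v) (hm u v) (hr u) (hr v)).congr fun ε => ?_
  have h : ∀ u, (ε ^ (α t - 1 / 2))⁻¹ • (ouElement α lam (t + ε * u) - ouElement α lam t) +
      -((ε ^ (α t - 1 / 2))⁻¹ • (spectralRe (kernel lam (α (t + ε * u)) 0) -
        spectralRe (kernel lam (α t) 0))) =
      (ε ^ (α t - 1 / 2))⁻¹ • (mbmElement α lam (t + ε * u) - mbmElement α lam t) := fun u => by
    simp only [ouElement, mbmElement]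
    rw [← smul_neg, ← smul_add]
    congr 1
    abel
  rw [h, h]

/-- Fractional Brownian motion built from the white noise. -/
def noiseFBM {Ω : Type*} (η : Lp ℝ 2 (volume : Measure ℝ) → Ω → ℝ) (a u : ℝ) (ω : Ω) : ℝ :=
  (Real.sqrt (tangentConst a))⁻¹ * η (fbmElement a u) ω

lemma sqrt_mul_noiseFBM {Ω : Type*} (η : Lp ℝ 2 (volume : Measure ℝ) → Ω → ℝ) {a : ℝ}
    (ha : 1 / 2 < a) (ha' : a < 3 / 2) :
    (fun u ω => Real.sqrt (tangentConst a) * noiseFBM η a u ω) =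
      fun u ω => η (fbmElement a u) ω := by
  ext u ω
  rw [noiseFBM, mul_inv_cancel_left₀ (Real.sqrt_pos.2 (tangentConst_pos ha ha')).ne']

lemma isFBM_noiseFBM {Ω : Type*} [MeasurableSpace Ω] {P : Measure Ω}
    {η : Lp ℝ 2 (volume : Measure ℝ) → Ω → ℝ} (hη : IsWhiteNoise η P) {a : ℝ}
    (ha : 1 / 2 < a) (ha' : a < 3 / 2) :
    IsFBM (a - 1 / 2) (noiseFBM η a) P where
  hurst := ⟨by linarith, by linarith⟩
  gaussian := (hη.gaussian.comp_right (fbmElement a)).smul fun _ => (Real.sqrt (tangentConst a))⁻¹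
  centred u := by simp only [noiseFBM, integral_const_mul, hη.centred, mul_zero]
  covariance u v := by
    have hc := tangentConst_pos ha ha'
    have h : ∀ ω, noiseFBM η a u ω * noiseFBM η a v ω =
        (tangentConst a)⁻¹ * (η (fbmElement a u) ω * η (fbmElement a v) ω) := fun ω => by
      rw [noiseFBM, noiseFBM, mul_mul_mul_comm, ← mul_inv, Real.mul_self_sqrt hc.le]
    simp_rw [h]
    rw [integral_const_mul, hη.covariance, inner_fbmElement ha ha',
      show 2 * (a - 1 / 2) = 2 * a - 1 by ring]
    field_simp

/-! ### From inner products in L² back to processes. -/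

section Noise

variable {Ω : Type*} [MeasurableSpace Ω] {P : Measure Ω} [IsProbabilityMeasure P]
  {η : Lp ℝ 2 (volume : Measure ℝ) → Ω → ℝ}

lemma temperedMBM_ae (hη : IsWhiteNoise η P) (α : ℝ → ℝ) (lam t : ℝ) :
    temperedMBM η α lam t =ᵐ[P] η (mbmElement α lam t) :=
  hη.sub_ae _ _

variable {Z : ℝ → Ω → ℝ} {Φ : ℝ → Lp ℝ 2 (volume : Measure ℝ)}

lemma rescaled_increment_ae (hη : IsWhiteNoise η P) (hZ : ∀ s, Z s =ᵐ[P] η (Φ s)) (t s c : ℝ) :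
    (fun ω => (Z s ω - Z t ω) / c) =ᵐ[P] η (c⁻¹ • (Φ s - Φ t)) := by
  filter_upwards [hZ s, hZ t, hη.sub_ae (Φ s) (Φ t), hη.div_ae c (Φ s - Φ t)] with ω h1 h2 h3 h4
  rw [← h4, ← h3, h1, h2]

lemma rescaledCov_eq (hη : IsWhiteNoise η P) (hZ : ∀ s, Z s =ᵐ[P] η (Φ s)) (t H ε u v : ℝ) :
    rescaledCov Z P t H ε u v = inner ℝ ((ε ^ H)⁻¹ • (Φ (t + ε * u) - Φ t))
      ((ε ^ H)⁻¹ • (Φ (t + ε * v) - Φ t)) := by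
  rw [← hη.covariance, rescaledCov]
  refine integral_congr_ae ?_
  filter_upwards [rescaled_increment_ae hη hZ t (t + ε * u) (ε ^ H),
    rescaled_increment_ae hη hZ t (t + ε * v) (ε ^ H)] with ω h1 h2
  rw [h1, h2]

/-- A process represented by white noise whose rescaled increments have asymptotically the
covariance of fractional Brownian motion is locally asymptotically self-similar. -/
lemma isLocallyAsymptoticallySelfSimilar_of_tendsto (hη : IsWhiteNoise η P)
    (hZ : ∀ s, Z s =ᵐ[P] η (Φ s)) {a t : ℝ} (ha : 1 / 2 < a) (ha' : a < 3 / 2)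
    (h : ∀ u v, Tendsto (fun ε => rescaledCov Z P t (a - 1 / 2) ε u v) (𝓝[>] 0)
      (𝓝 (tangentConst a / 2 *
        (|u| ^ (2 * a - 1) + |v| ^ (2 * a - 1) - |u - v| ^ (2 * a - 1))))) :
    IsLocallyAsymptoticallySelfSimilar Z P t (a - 1 / 2)
      (fun u ω => Real.sqrt (tangentConst a) * noiseFBM η a u ω) P := by
  rw [sqrt_mul_noiseFBM η ha ha']
  refine ⟨fun I => ?_, fun u hu c hc => ?_⟩
  · have hX : ∀ ε : ℝ, IsGaussianProcess
        (fun (u : ℝ) ω => (Z (t + ε * u) ω - Z t ω) / ε ^ (a - 1 / 2)) P := fun ε =>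
      (hη.gaussian.comp_right fun u => (ε ^ (a - 1 / 2))⁻¹ • (Φ (t + ε * u) - Φ t)).congr
        fun u => (rescaled_increment_ae hη hZ t (t + ε * u) (ε ^ (a - 1 / 2))).symm
    refine tendstoInDistribution_of_tendsto_covariance
      (X := fun ε (u : I) ω => (Z (t + ε * (u : ℝ)) ω - Z t ω) / ε ^ (a - 1 / 2))
      (T := fun (u : I) ω => η (fbmElement a u) ω) (fun ε => (hX ε).hasGaussianLaw I)
      (fun ε u => ?_) ((hη.gaussian.comp_right (fbmElement a)).hasGaussianLaw I)
      (fun u => hη.centred _) fun u v => ?_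
    · rw [integral_congr_ae (rescaled_increment_ae hη hZ t (t + ε * u) (ε ^ (a - 1 / 2))),
        hη.centred]
    · rw [hη.covariance, inner_fbmElement ha ha']
      exact h u v
  -- A constant value must equal the mean 0, which contradicts the positive variance of the limit at
  -- u ≠ 0.
  · have hc0 : c = 0 := by
      have := integral_congr_ae hc
      simpa [hη.centred] using this.symm
    have hv := hη.covariance (fbmElement a u) (fbmElement a u)
    have hz : ∫ ω, η (fbmElement a u) ω * η (fbmElement a u) ω ∂P = 0 := by
      rw [integral_congr_ae (g := fun _ => (0 : ℝ))]
      · simp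
      · filter_upwards [hc] with ω hω
        rw [hω, hc0, mul_zero]
    rw [hz, inner_fbmElement ha ha', sub_self, abs_zero,
      Real.zero_rpow (by linarith : 2 * a - 1 ≠ 0), sub_zero] at hv
    have h1 : 0 < |u| ^ (2 * a - 1) := Real.rpow_pos_of_pos (abs_pos.2 hu) _
    have := tangentConst_pos ha ha'
    have : 0 < tangentConst a / 2 * (|u| ^ (2 * a - 1) + |u| ^ (2 * a - 1)) := by positivity
    exact this.ne hv

end Noise

end TangentProcess

end TMBM
end
theorem mainTheorem10 {Ω : Type*} [MeasurableSpace Ω] (P : Measure Ω) [IsProbabilityMeasure P]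
    (η : Lp ℝ 2 (volume : Measure ℝ) → Ω → ℝ) (hη : TMBM.IsWhiteNoise η P)
    (lam : ℝ) (hlam : 0 < lam) (K κ : ℝ≥0) (hκ : κ ≤ 1)
    (α : ℝ → ℝ) (hα : HolderWith K κ α)
    (hbd : ∀ t, 1 / 2 < α t ∧ α t < (κ : ℝ) + 1 / 2) (t : ℝ) :
    0 < TMBM.tangentConst (α t) ∧
    (∀ u v : ℝ, Tendsto
      (fun ε => TMBM.rescaledCov (TMBM.multifractionalOU η α lam) P t (α t - 1 / 2) ε u v)
      (𝓝[>] 0)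
      (𝓝 (TMBM.tangentConst (α t) / 2 *
        (|u| ^ (2 * α t - 1) + |v| ^ (2 * α t - 1) - |u - v| ^ (2 * α t - 1))))) ∧
    (∀ u v : ℝ, Tendsto
      (fun ε => TMBM.rescaledCov (TMBM.temperedMBM η α lam) P t (α t - 1 / 2) ε u v)
      (𝓝[>] 0)
      (𝓝 (TMBM.tangentConst (α t) / 2 *
        (|u| ^ (2 * α t - 1) + |v| ^ (2 * α t - 1) - |u - v| ^ (2 * α t - 1))))) ∧
    ∃ W : ℝ → Ω → ℝ, TMBM.IsFBM (α t - 1 / 2) W P ∧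
      TMBM.IsLocallyAsymptoticallySelfSimilar (TMBM.multifractionalOU η α lam) P t (α t - 1 / 2)
        (fun u ω => Real.sqrt (TMBM.tangentConst (α t)) * W u ω) P ∧
      TMBM.IsLocallyAsymptoticallySelfSimilar (TMBM.temperedMBM η α lam) P t (α t - 1 / 2)
        (fun u ω => Real.sqrt (TMBM.tangentConst (α t)) * W u ω) P := by
  have hκ' : (κ : ℝ) ≤ 1 := by exact_mod_cast hκ
  have ha := (hbd t).1
  have ha' : α t < 3 / 2 := by linarith [(hbd t).2]
  -- Here equality is definitional; for tempered multifractional Brownian motion it needs the almost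
  -- sure linearity of the noise.
  have hY : ∀ s, TMBM.multifractionalOU η α lam s =ᵐ[P] η (TMBM.ouElement α lam s) :=
    fun s => Filter.EventuallyEq.rfl
  have hB := TMBM.temperedMBM_ae hη α lam
  have h1 := fun u v => (TMBM.tendsto_inner_ouElement hlam hκ hα hbd t u v).congr fun ε =>
    (TMBM.rescaledCov_eq hη hY t (α t - 1 / 2) ε u v).symm
  have h2 := fun u v => (TMBM.tendsto_inner_mbmElement hlam hκ hα hbd t u v).congr fun ε =>
    (TMBM.rescaledCov_eq hη hB t (α t - 1 / 2) ε u v).symm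
  exact ⟨TMBM.tangentConst_pos ha ha', h1, h2, TMBM.noiseFBM η (α t),
    TMBM.isFBM_noiseFBM hη ha ha',
    TMBM.isLocallyAsymptoticallySelfSimilar_of_tendsto hη hY ha ha' h1,
    TMBM.isLocallyAsymptoticallySelfSimilar_of_tendsto hη hB ha ha' h2⟩
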